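/- Let $t:\mathbb{N}\to\mathbb{N}$ be superlinear ($n=o(t(n))$) and time-constructible (some Turing machine computes $t(n)$ in binary from $1^n$ in $O(t(n))$ steps). For $X\in\{0,1\}^{\infty}$ let $X\upharpoonright n=X_0\dots X_{n-1}$, and let $A\uplus B=A_0B_0A_1B_1\dots$. Let $Z\in\{0,1\}^\infty$. A *$t^Z$-bounded lookahead martingale* is given by a deterministic multi-tape Turing machine $M$ with two oracles, the fixed sequence $Z$ and the sequence $X$ that is bet on (positions to be queried are written in binary on query tapes). For every $X$ and $n$, on input $X\upharpoonright n$ the machine outputs a nonnegative rational $d^X(n)$, the capital after $n$ bits, in $O(t(n))$ steps (with a constant that depends on neither $X$ nor $n$). Let $L^X_0=\emptyset$; if $n\in L^X_n$ let $L^X_{n+1}=L^X_n$; and if $n\notin L^X_n$ let $L^X_{n+1}=L^X_n\cup S$, where $S$ is the set of positions of $X$ that $M$ queries on input $X\upharpoonright(n+1)$. It is required that, for all $X$ and $n$: 1. $d^X(0)=1$; 2. if $n\notin L^X_n$, then every queried position $p\in S$ satisfies $p\ne n$, and either $p<n$ or $p=O(t(n+1))$ (again with a uniform constant); 3. if $n\notin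 L^X_n$, then $d^{X^0}(n+1)+d^{X^1}(n+1)=2\,d^X(n)$, where $X^b$ is $X$ with its bit at position $n$ replaced by $b$; 4. if $n\in L^X_n$, then $d^X(n+1)=d^X(n)$ (betting on a bit that has already been revealed is forbidden). It *succeeds* on $X$ if $\limsup_{n\to\infty} d^X(n)=\infty$. A sequence $X$ is *$t^Z$-lookahead nonrandom* if some $t^Z$-bounded lookahead martingale succeeds on it, and *$t^Z$-lookahead random* otherwise. The notions without $Z$ ($t$-lookahead random and nonrandom) are those for $Z=000\dots$, that is, without an external oracle. **Lemma.** There are a $t$-lookahead random sequence $B$ and a $t^B$-lookahead random sequence $A$ such that $A\uplus B$ is $t$-lookahead nonrandom. -/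

import Mathlib

open Filter Topology Asymptotics

/-! ### Oracle Turing machines with a step count

Deterministic multi-tape Turing machines over the symbols `0`, `1` and blank (`Option Bool`, where
`none` is the blank). Besides `k` work tapes there is an input tape, one query tape for each of
the two oracles, and two output tapes, which hold the numerator and the denominator of a rational
number. Numbers are written in binary, least significant bit in cell `0`. -/

/-- Infinite binary sequences. -/
abbrev BinSeq : Type := ℕ → Bool

/-- The names of the tapes of a machine with `k` work tapes. -/
inductive TapeName (k : ℕ) : Type
  | input
  | lookaheadQuery
  | externalQuery
  | numerator
  | denominator
  | work (i : Fin k)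

/-- Head movements. -/
inductive HeadMove : Type
  | left
  | stay
  | right

/-- A two-way infinite tape together with the position of its head. -/
structure TMTape : Type where
  cells : ℤ → Option Bool
  head : ℤ

namespace TMTape

/-- The tape holding the word `w` in the cells `0, 1, …, |w| - 1`, blank elsewhere, head on `0`. -/
def ofWord (w : List Bool) : TMTape where
  cells i := if 0 ≤ i then w[i.toNat]? else none
  head := 0

/-- The scanned symbol. -/
def read (T : TMTape) : Option Bool := T.cells T.head

/-- Overwrite the scanned symbol. -/
def write (T : TMTape) (a : Option Bool) : TMTape :=
  { T with cells := Function.update T.cells T.head a }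

/-- Move the head. -/
def move (T : TMTape) : HeadMove → TMTape
  | .left => { T with head := T.head - 1 }
  | .stay => T
  | .right => { T with head := T.head + 1 }

open Classical in
/-- The word written in the cells `0, 1, 2, …` up to the first blank. (In a run only finitely many
cells are ever nonblank, so that there is a first blank.) -/
noncomputable def word (T : TMTape) : List Bool :=
  if h : ∃ n : ℕ, T.cells n = none then
    (List.range (Nat.find h)).map (fun i : ℕ => (T.cells i).getD false)
  else []

/-- The natural number written in binary on the tape. -/
noncomputable def number (T : TMTape) : ℕ :=
  Nat.ofDigits 2 (T.word.map Bool.toNat)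

end TMTape

/-- The two oracles of a machine: the sequence that is being bet on, and an external sequence. -/
inductive OracleName : Type
  | lookahead
  | external

/-- What a machine with `k` work tapes and state set `Q` does in a given state: it halts; or, as a
function of the scanned symbols, it enters a new state, writes one symbol on each tape and moves
each head; or it asks one of the oracles for the bit whose position is written on the corresponding
query tape, and enters a new state that depends on the answer. -/
inductive Instr (k : ℕ) (Q : Type) : Type
  | halt
  | act (f : (TapeName k → Option Bool) → Q × (TapeName k → Option Bool × HeadMove))
  | ask (o : OracleName) (g : Bool → Q)

/-- A multi-tape Turing machine with two oracles. -/
structure OracleTM : Type 1 where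
  k : ℕ
  Q : Type
  finQ : Finite Q
  start : Q
  instr : Q → Instr k Q

namespace OracleTM

/-- Configurations. -/
structure Cfg (M : OracleTM) : Type where
  state : M.Q
  tape : TapeName M.k → TMTape

/-- The initial configuration on input `w`. -/
def init (M : OracleTM) (w : List Bool) : M.Cfg where
  state := M.start
  tape
    | .input => TMTape.ofWord w
    | _ => TMTape.ofWord []

/-- One step of the machine, with lookahead oracle `X` and external oracle `Z`. A halting
configuration is left unchanged. -/
noncomputable def step (M : OracleTM) (X Z : BinSeq) (c : M.Cfg) : M.Cfg :=
  match M.instr c.state with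
  | .halt => c
  | .act f =>
      let r := f (fun i => (c.tape i).read)
      { state := r.1
        tape := fun i => ((c.tape i).write (r.2 i).1).move (r.2 i).2 }
  | .ask .lookahead g => { c with state := g (X (c.tape .lookaheadQuery).number) }
  | .ask .external g => { c with state := g (Z (c.tape .externalQuery).number) }

/-- The configuration after `s` steps on input `w`. -/
noncomputable def cfgAt (M : OracleTM) (X Z : BinSeq) (w : List Bool) (s : ℕ) : M.Cfg :=
  (M.step X Z)^[s] (M.init w)

/-- On input `w` the machine halts after at most `s` steps. -/
def HaltsWithin (M : OracleTM) (X Z : BinSeq) (w : List Bool) (s : ℕ) : Prop :=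
  M.instr (M.cfgAt X Z w s).state = .halt

/-- On input `w` the machine halts after at most `s` steps, and the number on its numerator tape
is then `m`. -/
def OutputsNatWithin (M : OracleTM) (X Z : BinSeq) (w : List Bool) (s m : ℕ) : Prop :=
  M.HaltsWithin X Z w s ∧ ((M.cfgAt X Z w s).tape .numerator).number = m

/-- On input `w` the machine halts after at most `s` steps, and the nonnegative rational number
on its output tapes is then `v`. -/
def OutputsRatWithin (M : OracleTM) (X Z : BinSeq) (w : List Bool) (s : ℕ) (v : ℚ) : Prop :=
  M.HaltsWithin X Z w s ∧
    ((M.cfgAt X Z w s).tape .denominator).number ≠ 0 ∧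
    v = (((M.cfgAt X Z w s).tape .numerator).number : ℚ) /
      (((M.cfgAt X Z w s).tape .denominator).number : ℚ)

/-- The set of positions of the lookahead oracle that are queried in the run on input `w`. -/
def queried (M : OracleTM) (X Z : BinSeq) (w : List Bool) : Set ℕ :=
  {p | ∃ s g, M.instr (M.cfgAt X Z w s).state = .ask .lookahead g ∧
    ((M.cfgAt X Z w s).tape .lookaheadQuery).number = p}

end OracleTM

/-! ### Time bounds -/

/-- The sequence of zeros; as an oracle, it carries no information. -/
def zeroSeq : BinSeq := fun _ => false

/-- `t` is superlinear: `n = o(t(n))`. -/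
def Superlinear (t : ℕ → ℕ) : Prop :=
  (fun n : ℕ => (n : ℝ)) =o[atTop] (fun n : ℕ => (t n : ℝ))

/-- `t` is time-constructible: some machine (without oracles) computes the binary representation
of `t n` from the input `1ⁿ` in `O(t n)` steps. -/
def TimeConstructible (t : ℕ → ℕ) : Prop :=
  ∃ (M : OracleTM) (c : ℕ), ∀ n : ℕ,
    M.OutputsNatWithin zeroSeq zeroSeq (List.replicate n true) (c * t n + c) (t n)

/-! ### Lookahead martingales -/

/-- The first `n` bits of `X`. -/
def BinSeq.take (X : BinSeq) (n : ℕ) : List Bool := (List.range n).map X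

open Classical in
/-- The set `L` of the positions of `X` that have been revealed by lookahead when the bits at the
positions `0, …, n - 1` have been processed: the computation of the capital after `n + 1` bits adds
the positions that it queries, except when betting on position `n` is forbidden because that
position is already in the set. -/
noncomputable def revealed (M : OracleTM) (X Z : BinSeq) : ℕ → Set ℕ
  | 0 => ∅
  | n + 1 =>
      if n ∈ revealed M X Z n then revealed M X Z n
      else revealed M X Z n ∪ M.queried X Z (X.take (n + 1))

/-- `M`, with external oracle `Z`, computes the `t`-bounded lookahead martingale `d`. As the bets
may depend on bits ahead of the current position, the capital `d X n` after the first `n` bits of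
`X` is a function of `X` and `n`; it is computed from the input `X.take n` and from queries to
`X` (and to `Z`). -/
structure IsLookaheadMartingale (t : ℕ → ℕ) (Z : BinSeq) (M : OracleTM)
    (d : BinSeq → ℕ → ℚ) : Prop where
  /-- The capital after `n` bits is computed in `O(t n)` steps. -/
  computes : ∃ c : ℕ, ∀ (X : BinSeq) (n : ℕ),
    M.OutputsRatWithin X Z (X.take n) (c * t n + c) (d X n)
  /-- Where betting on position `n` is allowed, only positions other than `n` are queried, and
  these are either smaller than `n` or `O(t (n + 1))`. -/
  queries : ∃ c : ℕ, ∀ (X : BinSeq) (n : ℕ), n ∉ revealed M X Z n →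
    ∀ p ∈ M.queried X Z (X.take (n + 1)), p ≠ n ∧ (p < n ∨ p ≤ c * t (n + 1) + c)
  /-- The initial capital is `1`. -/
  init : ∀ X : BinSeq, d X 0 = 1
  /-- Where betting on position `n` is allowed, the bet is fair. -/
  fair : ∀ (X : BinSeq) (n : ℕ), n ∉ revealed M X Z n →
    d (Function.update X n false) (n + 1) + d (Function.update X n true) (n + 1) = 2 * d X n
  /-- On a position that has been revealed, betting is forbidden. -/
  frozen : ∀ (X : BinSeq) (n : ℕ), n ∈ revealed M X Z n → d X (n + 1) = d X n

/-- The capital is unbounded along `X`: `limsup d X n = ∞`. -/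
def SucceedsOn (d : BinSeq → ℕ → ℚ) (X : BinSeq) : Prop :=
  limsup (fun n : ℕ => (((d X n : ℚ) : ℝ) : EReal)) atTop = ⊤

/-- `X` is `t^Z`-lookahead nonrandom: some `t`-bounded lookahead martingale with oracle access to
`Z` succeeds on `X`. -/
def LookaheadNonrandomRel (t : ℕ → ℕ) (Z X : BinSeq) : Prop :=
  ∃ (M : OracleTM) (d : BinSeq → ℕ → ℚ), IsLookaheadMartingale t Z M d ∧ SucceedsOn d X

/-- `X` is `t^Z`-lookahead random. -/
def LookaheadRandomRel (t : ℕ → ℕ) (Z X : BinSeq) : Prop :=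
  ¬ LookaheadNonrandomRel t Z X

/-- `X` is `t`-lookahead nonrandom. -/
def LookaheadNonrandom (t : ℕ → ℕ) (X : BinSeq) : Prop :=
  LookaheadNonrandomRel t zeroSeq X

/-- `X` is `t`-lookahead random. -/
def LookaheadRandom (t : ℕ → ℕ) (X : BinSeq) : Prop :=
  ¬ LookaheadNonrandom t X

/-- The interleaving `A₀ B₀ A₁ B₁ …`. -/
def interleave (A B : BinSeq) : BinSeq :=
  fun n => if n % 2 = 0 then A (n / 2) else B (n / 2)

/-! Let the bits of `A` be independent fair coins, and let `B` repeat the bit `A k` at the position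
`g k` and consist of fresh coins elsewhere. Here `g` grows so fast that, for every `c` and all large
`k`, `2 ^ (c * t i + c) ≤ g k` for all `i ≤ k + 1`. A run of `s` steps can only query positions
below `2 ^ s`, so the copy of `A k` in `B` is out of reach when the bet on `A k` is computed.
Flipping the coin `A k` thus disturbs no part of `B` that can be seen at that moment. The bits of
`B` are distinct coins, so `B` alone is uniform. Almost surely, therefore, `B` is random and `A` is
random relative to `B` (`measure_lookaheadNonrandomRel`, `exists_random_planted`).

The almost sure statement replaces conditional expectations by flips. If position `n` has not been
revealed, flipping bit `n` preserves the capital up to time `n`, and the two capitals at time `n +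
1` average to the capital at time `n` (`FairUpTo.flip`, `FairUpTo.capital_add_capital_flip`); if it
has been revealed, the capital stands still. A maximal inequality for such processes
(`IsFairGame.measure_unbounded`) shows that one machine with one time constant succeeds with
probability zero, and there are countably many of these pairs.

In the interleaving, the bit at `2 * k` reappears at `2 * g k + 1`. A gambler who stakes everything
on this coincidence doubles the capital infinitely often without any lookahead, but has to recognise
the positions `2 * g k + 1` in linear time. So `g` is not given by a formula; it is read off from
the run of a `Clockwork`, which makes one step per bit of the sequence. The one used here runs the
machine that computes `t` on longer and longer inputs, counts its steps and lets the count grow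
exponentially before each check, which delays the checks beyond all bounds `2 ^ (c * t i + c)`
(`TimeConstructible.exists_oddChecks`). `Clockwork.lookaheadNonrandom` turns it into a martingale
with running time `3 * n + 3`, which is `O(t n)` by superlinearity. -/

/-! ### Runs of oracle machines -/

namespace TMTape

/-- The head and the nonblank cells are where they can be after `n` steps from a blank tape. -/
def Within (n : ℕ) (T : TMTape) : Prop :=
  |T.head| ≤ n ∧ ∀ z, T.cells z ≠ none → |z| < n

theorem within_blank : Within 0 (ofWord []) := by
  refine ⟨by simp [ofWord], fun z hz => ?_⟩
  simp [ofWord] at hz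

theorem Within.mono {m n : ℕ} {T : TMTape} (h : Within m T) (hmn : m ≤ n) : Within n T := by
  have : (m : ℤ) ≤ n := by exact_mod_cast hmn
  exact ⟨h.1.trans this, fun z hz => (h.2 z hz).trans_le this⟩

theorem Within.write_move {n : ℕ} {T : TMTape} (h : Within n T) (a : Option Bool) (m : HeadMove) :
    Within (n + 1) ((T.write a).move m) := by
  obtain ⟨h1, h2⟩ := h
  have hc : ∀ z, (T.write a).cells z ≠ none → |z| < ((n + 1 : ℕ) : ℤ) := by
    intro z hz
    by_cases hzh : z = T.head
    · subst hzh; push_cast; omega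
    · have := h2 z (by simpa [write, Function.update_of_ne hzh] using hz)
      push_cast; omega
  have hh : (T.write a).head = T.head := rfl
  rw [abs_le] at h1
  cases m
  · exact ⟨by simp only [move, hh]; rw [abs_le]; push_cast; omega, hc⟩
  · exact ⟨by simp only [move, hh]; rw [abs_le]; push_cast; omega, hc⟩
  · exact ⟨by simp only [move, hh]; rw [abs_le]; push_cast; omega, hc⟩

/-- The number ends at the first blank, and cell `n` is blank, so there are at most `n` binary
digits. This is what limits the reach of oracle queries. -/
theorem Within.number_lt {n : ℕ} {T : TMTape} (h : Within n T) : T.number < 2 ^ n := by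
  have hn : T.cells n = none := by
    by_contra hc
    have := h.2 _ hc
    simp at this
  have hex : ∃ n : ℕ, T.cells n = none := ⟨n, hn⟩
  have hlen : (T.word.map Bool.toNat).length ≤ n := by
    simp only [word, dif_pos hex, List.length_map, List.length_range]
    exact Nat.find_min' hex hn
  refine lt_of_lt_of_le (Nat.ofDigits_lt_base_pow_length (b := 2) (by norm_num) ?_)
    (Nat.pow_le_pow_right (by norm_num) hlen)
  intro x hx
  obtain ⟨b, -, rfl⟩ := List.mem_map.1 hx
  cases b <;> simp

end TMTape

namespace OracleTM

theorem cfgAt_zero (M : OracleTM) (X Z : BinSeq) (w : List Bool) : M.cfgAt X Z w 0 = M.init w := rfl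

theorem cfgAt_succ (M : OracleTM) (X Z : BinSeq) (w : List Bool) (s : ℕ) :
    M.cfgAt X Z w (s + 1) = M.step X Z (M.cfgAt X Z w s) :=
  Function.iterate_succ_apply' _ _ _

theorem step_of_halt {M : OracleTM} {X Z : BinSeq} {c : M.Cfg} (h : M.instr c.state = .halt) :
    M.step X Z c = c := by
  simp [step, h]

theorem HaltsWithin.cfgAt_eq {M : OracleTM} {X Z : BinSeq} {w : List Bool} {s j : ℕ}
    (h : M.HaltsWithin X Z w s) (hj : s ≤ j) : M.cfgAt X Z w j = M.cfgAt X Z w s := by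
  induction j, hj using Nat.le_induction with
  | base => rfl
  | succ j _ ih => rw [cfgAt_succ, ih, step_of_halt h]

theorem HaltsWithin.mono {M : OracleTM} {X Z : BinSeq} {w : List Bool} {s j : ℕ}
    (h : M.HaltsWithin X Z w s) (hj : s ≤ j) : M.HaltsWithin X Z w j := by
  unfold HaltsWithin
  rw [h.cfgAt_eq hj]
  exact h

theorem OutputsRatWithin.mono {M : OracleTM} {X Z : BinSeq} {w : List Bool} {s j : ℕ} {v : ℚ}
    (h : M.OutputsRatWithin X Z w s v) (hj : s ≤ j) : M.OutputsRatWithin X Z w j v := by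
  refine ⟨h.1.mono hj, ?_⟩
  rw [h.1.cfgAt_eq hj]
  exact h.2

theorem step_within {M : OracleTM} {X Z : BinSeq} {c : M.Cfg} {n : ℕ} {i : TapeName M.k}
    (h : (c.tape i).Within n) : ((M.step X Z c).tape i).Within (n + 1) := by
  unfold step
  split
  · exact h.mono (Nat.le_succ n)
  · exact h.write_move _ _
  · exact h.mono (Nat.le_succ n)
  · exact h.mono (Nat.le_succ n)

theorem cfgAt_within (M : OracleTM) (X Z : BinSeq) (w : List Bool) (s : ℕ) {i : TapeName M.k}
    (hi : i ≠ .input) : ((M.cfgAt X Z w s).tape i).Within s := by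
  induction s with
  | zero =>
    rw [cfgAt_zero]
    cases i <;> first | exact absurd rfl hi | exact TMTape.within_blank
  | succ s ih =>
    rw [cfgAt_succ]
    exact step_within ih

/-- The run of a machine depends only on the values of the oracles that it can query. -/
theorem HaltsWithin.cfgAt_congr {M : OracleTM} {X X' Z Z' : BinSeq} {w : List Bool} {s : ℕ}
    (hs : M.HaltsWithin X Z w s) (hX : ∀ p ∈ M.queried X Z w, X' p = X p)
    (hZ : ∀ p < 2 ^ s, Z' p = Z p) (j : ℕ) : M.cfgAt X' Z' w j = M.cfgAt X Z w j := by
  induction j with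
  | zero => rfl
  | succ j ih =>
    rw [cfgAt_succ, cfgAt_succ, ih]
    rcases le_or_gt s j with hj | hj
    · have := hs.mono hj
      rw [step_of_halt this, step_of_halt this]
    · rcases hi : M.instr (M.cfgAt X Z w j).state with _ | f | ⟨_ | _, g⟩
      · simp [step, hi]
      · simp [step, hi]
      · simp only [step, hi]
        rw [hX _ ⟨j, g, hi, rfl⟩]
      · simp only [step, hi]
        rw [hZ _]
        refine (M.cfgAt_within X Z w j (by simp)).number_lt.trans_le ?_
        exact Nat.pow_le_pow_right (by norm_num) hj.le

theorem HaltsWithin.queried_congr {M : OracleTM} {X X' Z Z' : BinSeq} {w : List Bool} {s : ℕ}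
    (h : M.HaltsWithin X Z w s) (hX : ∀ p ∈ M.queried X Z w, X' p = X p)
    (hZ : ∀ p < 2 ^ s, Z' p = Z p) : M.queried X' Z' w = M.queried X Z w := by
  unfold queried
  simp only [h.cfgAt_congr hX hZ]

theorem HaltsWithin.queried_lt {M : OracleTM} {X Z : BinSeq} {w : List Bool} {s p : ℕ}
    (h : M.HaltsWithin X Z w s) (hp : p ∈ M.queried X Z w) : p < 2 ^ s := by
  obtain ⟨j, g, hj, rfl⟩ := hp
  have hjs : j < s := by
    by_contra hc
    have := h.mono (not_lt.1 hc)
    rw [HaltsWithin, hj] at this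
    cases this
  refine (M.cfgAt_within X Z w j (by simp)).number_lt.trans_le ?_
  exact Nat.pow_le_pow_right (by norm_num) hjs.le

/-! ### Renaming the states of a machine -/

/-- The machine whose states are renamed along `e`. -/
def relabel (M : OracleTM) {Q : Type} (e : M.Q ≃ Q) : OracleTM where
  k := M.k
  Q := Q
  finQ := Finite.of_equiv _ (h := M.finQ) e
  start := e M.start
  instr q :=
    match M.instr (e.symm q) with
    | .halt => .halt
    | .act f => .act fun r => (e (f r).1, (f r).2)
    | .ask o g => .ask o fun b => e (g b)

theorem relabel_cfgAt (M : OracleTM) {Q : Type} (e : M.Q ≃ Q) (X Z : BinSeq) (w : List Bool)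
    (s : ℕ) : (M.relabel e).cfgAt X Z w s =
      ⟨e (M.cfgAt X Z w s).state, (M.cfgAt X Z w s).tape⟩ := by
  induction s with
  | zero =>
    simp only [cfgAt_zero, init, relabel, Cfg.mk.injEq, true_and]
    funext i
    cases i <;> rfl
  | succ s ih =>
    rw [cfgAt_succ, ih, cfgAt_succ]
    rcases hi : M.instr (M.cfgAt X Z w s).state with _ | f | ⟨_ | _, g⟩ <;>
      simp [step, hi, relabel]

theorem relabel_haltsWithin (M : OracleTM) {Q : Type} (e : M.Q ≃ Q) (X Z : BinSeq) (w : List Bool)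
    (s : ℕ) : (M.relabel e).HaltsWithin X Z w s ↔ M.HaltsWithin X Z w s := by
  unfold HaltsWithin
  rw [relabel_cfgAt]
  rcases hi : M.instr (M.cfgAt X Z w s).state with _ | f | ⟨o, g⟩ <;> simp [relabel, hi]

theorem relabel_outputsRatWithin (M : OracleTM) {Q : Type} (e : M.Q ≃ Q) (X Z : BinSeq)
    (w : List Bool) (s : ℕ) (v : ℚ) :
    (M.relabel e).OutputsRatWithin X Z w s v ↔ M.OutputsRatWithin X Z w s v := by
  unfold OutputsRatWithin
  rw [relabel_haltsWithin, relabel_cfgAt]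
  rfl

theorem relabel_queried (M : OracleTM) {Q : Type} (e : M.Q ≃ Q) (X Z : BinSeq) (w : List Bool) :
    (M.relabel e).queried X Z w = M.queried X Z w := by
  ext p
  constructor
  · rintro ⟨s, g, h, hp⟩
    rw [relabel_cfgAt] at h hp
    rcases hi : M.instr (M.cfgAt X Z w s).state with _ | f | ⟨o, g'⟩
    · simp [relabel, hi] at h
    · simp [relabel, hi] at h
    · simp only [relabel, Equiv.symm_apply_apply, hi] at h
      injection h with h1 h2
      exact ⟨s, g', by rw [hi, h1], hp⟩
  · rintro ⟨s, g, h, hp⟩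
    refine ⟨s, fun b => e (g b), ?_, ?_⟩
    · rw [relabel_cfgAt]
      simp [relabel, h]
    · rw [relabel_cfgAt]
      exact hp

theorem relabel_revealed (M : OracleTM) {Q : Type} (e : M.Q ≃ Q) (X Z : BinSeq) (n : ℕ) :
    revealed (M.relabel e) X Z n = revealed M X Z n := by
  induction n with
  | zero => rfl
  | succ n ih => rw [revealed, revealed, ih, relabel_queried]

end OracleTM

theorem IsLookaheadMartingale.relabel {t : ℕ → ℕ} {Z : BinSeq} {M : OracleTM} {d : BinSeq → ℕ → ℚ}
    (h : IsLookaheadMartingale t Z M d) {Q : Type} (e : M.Q ≃ Q) :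
    IsLookaheadMartingale t Z (M.relabel e) d where
  computes := by simpa only [OracleTM.relabel_outputsRatWithin] using h.computes
  queries := by
    simpa only [OracleTM.relabel_revealed, OracleTM.relabel_queried] using h.queries
  init := h.init
  fair := by simpa only [OracleTM.relabel_revealed] using h.fair
  frozen := by simpa only [OracleTM.relabel_revealed] using h.frozen

/-! ### There are countably many machines -/

instance : Finite HeadMove :=
  Finite.of_injective (β := Fin 3) (fun | .left => 0 | .stay => 1 | .right => 2)
    (by intro a b; cases a <;> cases b <;> simp)

instance : Finite OracleName :=
  Finite.of_injective (β := Bool) (fun | .lookahead => false | .external => true)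
    (by intro a b; cases a <;> cases b <;> simp)

/-- Tape names as a sum type. -/
def TapeName.equiv (k : ℕ) : TapeName k ≃ Fin 5 ⊕ Fin k where
  toFun
    | .input => .inl 0
    | .lookaheadQuery => .inl 1
    | .externalQuery => .inl 2
    | .numerator => .inl 3
    | .denominator => .inl 4
    | .work i => .inr i
  invFun
    | .inl 0 => .input
    | .inl 1 => .lookaheadQuery
    | .inl 2 => .externalQuery
    | .inl 3 => .numerator
    | .inl 4 => .denominator
    | .inr i => .work i
  left_inv i := by cases i <;> rfl
  right_inv i := by
    rcases i with i | i
    · fin_cases i <;> rfl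
    · rfl

instance (k : ℕ) : Finite (TapeName k) := Finite.of_equiv _ (TapeName.equiv k).symm

instance (k : ℕ) (Q : Type) [Finite Q] : Finite (Instr k Q) := by
  let F : Instr k Q → Unit ⊕ ((TapeName k → Option Bool) → Q × (TapeName k → Option Bool × HeadMove))
      ⊕ (OracleName × (Bool → Q)) := fun
    | .halt => .inl ()
    | .act f => .inr (.inl f)
    | .ask o g => .inr (.inr (o, g))
  refine Finite.of_injective F ?_
  intro a b h
  cases a <;> cases b <;> simp_all [F]

/-- Descriptions of the machines whose states are numbered. -/
abbrev MachineCode : Type := Σ k : ℕ, Σ n : ℕ, Fin n × (Fin n → Instr k (Fin n))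

/-- The machine with a given description. -/
def MachineCode.machine (e : MachineCode) : OracleTM where
  k := e.1
  Q := Fin e.2.1
  finQ := inferInstance
  start := e.2.2.1
  instr := e.2.2.2

/-- Machines may use any finite type of states. Numbering the states brings them into a countable
family, as needed for a union of null sets. -/
theorem IsLookaheadMartingale.exists_code {t : ℕ → ℕ} {Z : BinSeq} {M : OracleTM}
    {d : BinSeq → ℕ → ℚ} (h : IsLookaheadMartingale t Z M d) :
    ∃ e : MachineCode, IsLookaheadMartingale t Z e.machine d := by
  have := M.finQ
  obtain ⟨n, ⟨e⟩⟩ := Finite.exists_equiv_fin M.Q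
  exact ⟨⟨M.k, n, (M.relabel e).start, (M.relabel e).instr⟩, h.relabel e⟩

theorem lookaheadNonrandomRel_iff_exists_code (t : ℕ → ℕ) (Z X : BinSeq) :
    LookaheadNonrandomRel t Z X ↔
      ∃ (e : MachineCode) (d : BinSeq → ℕ → ℚ),
        IsLookaheadMartingale t Z e.machine d ∧ SucceedsOn d X := by
  constructor
  · rintro ⟨M, d, h, hd⟩
    obtain ⟨e, he⟩ := h.exists_code
    exact ⟨e, d, he, hd⟩
  · rintro ⟨e, d, h, hd⟩
    exact ⟨_, d, h, hd⟩

/-! ### A maximal inequality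

A nonnegative process that is frozen outside the sets `S n` and, on `S n`, is fair under a measure
preserving involution that does not change its past, is almost surely bounded. The assumptions are
needed on a decreasing sequence of sets `G n` only. -/

section FairGame

open MeasureTheory ENNReal

/-- A process that is fair under involutions, from time `n₀` on and within the sets `G n`. -/
structure IsFairGame {Ω : Type*} [MeasurableSpace Ω] (μ : Measure Ω) (D : ℕ → Ω → ℝ≥0∞)
    (G S : ℕ → Set Ω) (φ : ℕ → Ω → Ω) (n₀ : ℕ) (K : ℝ≥0∞) : Prop where
  measurable : ∀ n, Measurable (D n)
  measurableSet_good : ∀ n, MeasurableSet (G n)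
  measurableSet_inter : ∀ n, MeasurableSet (G n ∩ S n)
  measurePreserving : ∀ n, MeasurePreserving (φ n) μ μ
  involutive : ∀ n, Function.Involutive (φ n)
  anti : Antitone G
  initial : ∀ ω ∈ G n₀, D n₀ ω ≤ K
  frozen : ∀ n ≥ n₀, ∀ ω ∈ G n, ω ∉ S n → D (n + 1) ω = D n ω
  mem : ∀ n ≥ n₀, ∀ ω ∈ G n ∩ S n, φ n ω ∈ G n ∩ S n
  past : ∀ n ≥ n₀, ∀ ω ∈ G n ∩ S n, ∀ i ≤ n, n₀ ≤ i → D i (φ n ω) = D i ω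
  fair : ∀ n ≥ n₀, ∀ ω ∈ G n ∩ S n, D (n + 1) ω + D (n + 1) (φ n ω) = 2 * D n ω

namespace IsFairGame

variable {Ω : Type*} [MeasurableSpace Ω] {μ : Measure Ω} {D : ℕ → Ω → ℝ≥0∞}
  {G S : ℕ → Set Ω} {φ : ℕ → Ω → Ω} {n₀ : ℕ} {K : ℝ≥0∞}

/-- On the part of `G n ∩ S n` where the process has stayed below `C`, which `φ n` maps onto itself,
averaging over `φ n` turns `D (n + 1)` into `D n`. On the rest of the domain of integration the
process is frozen. -/
theorem lintegral_eq (h : IsFairGame μ D G S φ n₀ K) (C : ℝ≥0∞) {n : ℕ} (hn : n₀ ≤ n) :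
    ∫⁻ ω in G n ∩ {ω | ∀ i ≤ n, n₀ ≤ i → D i ω < C}, D (n + 1) ω ∂μ =
      ∫⁻ ω in G n ∩ {ω | ∀ i ≤ n, n₀ ≤ i → D i ω < C}, D n ω ∂μ := by
  set L := {ω | ∀ i ≤ n, n₀ ≤ i → D i ω < C} with hL
  have mL : MeasurableSet L := by
    have : L = ⋂ i, ⋂ (_ : i ≤ n), ⋂ (_ : n₀ ≤ i), D i ⁻¹' Set.Iio C := by
      ext; simp [L]
    rw [this]
    exact MeasurableSet.iInter fun i => MeasurableSet.iInter fun _ => MeasurableSet.iInter fun _ =>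
      h.measurable i measurableSet_Iio
  set T := (G n ∩ S n) ∩ L with hT
  have mT : MeasurableSet T := (h.measurableSet_inter n).inter mL
  have hsplit : ∀ f : Ω → ℝ≥0∞,
      ∫⁻ ω in G n ∩ L, f ω ∂μ = ∫⁻ ω in T, f ω ∂μ + ∫⁻ ω in (G n ∩ L) \ T, f ω ∂μ := by
    intro f
    have : G n ∩ L = T ∪ (G n ∩ L) \ T :=
      (Set.union_sdiff_cancel (fun ω hω => ⟨hω.1.1, hω.2⟩ : T ⊆ G n ∩ L)).symm
    conv_lhs => rw [this]
    exact lintegral_union (((h.measurableSet_good n).inter mL).diff mT) Set.disjoint_sdiff_right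
  have hpre : φ n ⁻¹' T = T := by
    have key : ∀ ω ∈ T, φ n ω ∈ T := by
      intro ω hω
      refine ⟨h.mem n hn ω hω.1, fun i hi h0 => ?_⟩
      rw [h.past n hn ω hω.1 i hi h0]
      exact hω.2 i hi h0
    ext ω
    refine ⟨fun hω => ?_, key ω⟩
    have := key _ hω
    rwa [h.involutive n ω] at this
  have h1 : ∫⁻ ω in T, D (n + 1) ω ∂μ = ∫⁻ ω in T, D (n + 1) (φ n ω) ∂μ := by
    have := (h.measurePreserving n).setLIntegral_comp_preimage mT (h.measurable (n + 1))
    rw [hpre] at this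
    exact this.symm
  have h2 : ∫⁻ ω in T, D (n + 1) ω ∂μ = ∫⁻ ω in T, D n ω ∂μ := by
    -- Two copies of the integral: one of them is transported by `φ n`, and then fairness applies
    -- pointwise.
    have h3 : 2 * ∫⁻ ω in T, D (n + 1) ω ∂μ = 2 * ∫⁻ ω in T, D n ω ∂μ := by
      rw [← lintegral_const_mul _ (h.measurable n)]
      conv_lhs => rw [two_mul]
      conv_lhs => rhs; rw [h1]
      rw [← lintegral_add_left (h.measurable (n + 1))]
      exact setLIntegral_congr_fun mT fun ω hω => h.fair n hn ω hω.1
    exact (ENNReal.mul_right_inj (by norm_num) (by norm_num)).1 h3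
  rw [hsplit, hsplit, h2]
  congr 1
  refine setLIntegral_congr_fun (((h.measurableSet_good n).inter mL).diff mT) fun ω hω => ?_
  exact h.frozen n hn ω hω.1.1 fun hS => hω.2 ⟨⟨hω.1.1, hS⟩, hω.1.2⟩

/-- Doob's maximal inequality, for the process stopped when it first reaches `C`: the integral is
the capital still in play, and the other term bounds from below what the stopped paths have taken
out. Shrinking the good set only decreases the sum. -/
theorem lintegral_add_le [IsProbabilityMeasure μ] (h : IsFairGame μ D G S φ n₀ K) (C : ℝ≥0∞)
    {n : ℕ} (hn : n₀ ≤ n) :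
    ∫⁻ ω in G n ∩ {ω | ∀ i ≤ n, n₀ ≤ i → D i ω < C}, D n ω ∂μ +
      C * μ (G n ∩ {ω | ∃ i ≤ n, n₀ ≤ i ∧ C ≤ D i ω}) ≤ K := by
  have mge : ∀ i, MeasurableSet {ω | C ≤ D i ω} := fun i => h.measurable i measurableSet_Ici
  -- Markov's inequality on the part of `A` where `C` is reached at time `n`.
  have step : ∀ (A : Set Ω) (n : ℕ), MeasurableSet A →
      ∫⁻ ω in A ∩ {ω | D n ω < C}, D n ω ∂μ + C * μ (A ∩ {ω | C ≤ D n ω}) ≤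
        ∫⁻ ω in A, D n ω ∂μ := by
    intro A n mA
    have hA : A = (A ∩ {ω | D n ω < C}) ∪ (A ∩ {ω | C ≤ D n ω}) := by
      ext ω
      simp only [Set.mem_union, Set.mem_inter_iff, Set.mem_ofPred_eq, ← and_or_left]
      exact ⟨fun hω => ⟨hω, lt_or_ge _ _⟩, fun hω => hω.1⟩
    conv_rhs => rw [hA]
    rw [lintegral_union (mA.inter (mge n))]
    · gcongr
      rw [← setLIntegral_const]
      exact setLIntegral_mono' (mA.inter (mge n)) fun ω hω => hω.2
    · rw [Set.disjoint_left]
      rintro ω ⟨_, h1⟩ ⟨_, h2⟩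
      exact (not_lt.2 h2 : ¬ D n ω < C) h1
  induction n, hn using Nat.le_induction with
  | base =>
    calc _ ≤ ∫⁻ ω in G n₀ ∩ {ω | D n₀ ω < C}, D n₀ ω ∂μ + C * μ (G n₀ ∩ {ω | C ≤ D n₀ ω}) := by
          gcongr
          · exact fun hω => hω n₀ le_rfl le_rfl
          · rintro ⟨i, hi, hi', hC⟩
            rwa [le_antisymm hi hi'] at hC
      _ ≤ ∫⁻ ω in G n₀, D n₀ ω ∂μ := step _ _ (h.measurableSet_good _)
      _ ≤ ∫⁻ ω in G n₀, K ∂μ := setLIntegral_mono' (h.measurableSet_good _) h.initial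
      _ ≤ K := by
          rw [setLIntegral_const]
          exact mul_le_of_le_one_right' prob_le_one
  | succ n hn ih =>
    set L := {ω | ∀ i ≤ n, n₀ ≤ i → D i ω < C} with hL
    have mL : MeasurableSet L := by
      have : L = ⋂ i, ⋂ (_ : i ≤ n), ⋂ (_ : n₀ ≤ i), D i ⁻¹' Set.Iio C := by
        ext; simp [L]
      rw [this]
      exact MeasurableSet.iInter fun i => MeasurableSet.iInter fun _ =>
        MeasurableSet.iInter fun _ => h.measurable i measurableSet_Iio
    have h1 : G (n + 1) ∩ {ω | ∀ i ≤ n + 1, n₀ ≤ i → D i ω < C} ⊆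
        (G n ∩ L) ∩ {ω | D (n + 1) ω < C} := fun ω hω =>
      ⟨⟨h.anti (Nat.le_succ n) hω.1, fun i hi h0 => hω.2 i (by omega) h0⟩,
        hω.2 (n + 1) le_rfl (by omega)⟩
    have h2 : G (n + 1) ∩ {ω | ∃ i ≤ n + 1, n₀ ≤ i ∧ C ≤ D i ω} ⊆
        (G n ∩ {ω | ∃ i ≤ n, n₀ ≤ i ∧ C ≤ D i ω}) ∪ ((G n ∩ L) ∩ {ω | C ≤ D (n + 1) ω}) := by
      rintro ω ⟨hG, i, hi, h0, hC⟩
      have hG' := h.anti (Nat.le_succ n) hG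
      by_cases hω : ω ∈ L
      · rcases Nat.le_succ_iff.1 hi with hi | rfl
        · exact absurd (hω i hi h0) (not_lt.2 hC)
        · exact Or.inr ⟨⟨hG', hω⟩, hC⟩
      · simp only [hL, Set.mem_ofPred_eq, not_forall, not_lt] at hω
        obtain ⟨j, hj, hj0, hjC⟩ := hω
        exact Or.inl ⟨hG', j, hj, hj0, hjC⟩
    calc _ ≤ ∫⁻ ω in (G n ∩ L) ∩ {ω | D (n + 1) ω < C}, D (n + 1) ω ∂μ +
          C * (μ (G n ∩ {ω | ∃ i ≤ n, n₀ ≤ i ∧ C ≤ D i ω}) +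
            μ ((G n ∩ L) ∩ {ω | C ≤ D (n + 1) ω})) := by
          gcongr
          exact (measure_mono h2).trans (measure_union_le _ _)
      _ = (∫⁻ ω in (G n ∩ L) ∩ {ω | D (n + 1) ω < C}, D (n + 1) ω ∂μ +
            C * μ ((G n ∩ L) ∩ {ω | C ≤ D (n + 1) ω})) +
          C * μ (G n ∩ {ω | ∃ i ≤ n, n₀ ≤ i ∧ C ≤ D i ω}) := by ring
      _ ≤ ∫⁻ ω in G n ∩ L, D (n + 1) ω ∂μ +
          C * μ (G n ∩ {ω | ∃ i ≤ n, n₀ ≤ i ∧ C ≤ D i ω}) := by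
          gcongr
          exact step _ _ ((h.measurableSet_good n).inter mL)
      _ ≤ K := by
          rw [h.lintegral_eq C hn]
          exact ih

/-- The paths that reach `C` have measure at most `K / C` by the maximal inequality, in the limit of
increasing time horizons; `C` is arbitrary. -/
theorem measure_unbounded [IsProbabilityMeasure μ] (h : IsFairGame μ D G S φ n₀ K)
    (hK : K ≠ ⊤) : μ {ω | (∀ n, ω ∈ G n) ∧ ∀ C : ℕ, ∃ n ≥ n₀, (C : ℝ≥0∞) ≤ D n ω} = 0 := by
  have bound : ∀ C : ℕ,
      (C : ℝ≥0∞) * μ {ω | (∀ n, ω ∈ G n) ∧ ∃ n ≥ n₀, (C : ℝ≥0∞) ≤ D n ω} ≤ K := by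
    intro C
    have hU : {ω | (∀ n, ω ∈ G n) ∧ ∃ n ≥ n₀, (C : ℝ≥0∞) ≤ D n ω} =
        ⋃ n, {ω | (∀ n, ω ∈ G n) ∧ ∃ i ≤ n, n₀ ≤ i ∧ (C : ℝ≥0∞) ≤ D i ω} := by
      ext ω
      simp only [Set.mem_ofPred_eq, Set.mem_iUnion, exists_and_left, and_congr_right_iff]
      intro _
      constructor
      · rintro ⟨n, hn, hC⟩
        exact ⟨n, n, le_rfl, hn, hC⟩
      · rintro ⟨_, n, _, hn, hC⟩
        exact ⟨n, hn, hC⟩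
    rw [hU, Monotone.measure_iUnion, ENNReal.mul_iSup]
    · refine iSup_le fun n => ?_
      refine le_trans ?_ (h.lintegral_add_le (C : ℝ≥0∞) (le_max_left n₀ n))
      refine le_trans ?_ le_add_self
      gcongr
      rintro ω ⟨hG, i, hi, h0, hC⟩
      exact ⟨hG _, i, hi.trans (le_max_right _ _), h0, hC⟩
    · rintro m n hmn ω ⟨hG, i, hi, h0⟩
      exact ⟨hG, i, hi.trans hmn, h0⟩
  by_contra hne
  set c := μ {ω | (∀ n, ω ∈ G n) ∧ ∀ C : ℕ, ∃ n ≥ n₀, (C : ℝ≥0∞) ≤ D n ω} with hc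
  obtain ⟨C, hC⟩ := ENNReal.exists_nat_mul_gt hne hK
  refine absurd (bound C) (not_le.2 (hC.trans_le ?_))
  rw [hc]
  refine mul_le_mul_right (measure_mono ?_) _
  rintro ω ⟨hG, h⟩
  exact ⟨hG, h C⟩

end IsFairGame

end FairGame

/-! ### The capital as a function of both oracles -/

namespace OracleTM

/-- Within `s` steps a machine sees only the values of the oracles below `2 ^ s`. -/
theorem cfgAt_congr_of_lt {M : OracleTM} {X X' Z Z' : BinSeq} {w : List Bool} {s : ℕ}
    (hX : ∀ p < 2 ^ s, X' p = X p) (hZ : ∀ p < 2 ^ s, Z' p = Z p) {j : ℕ} (hj : j ≤ s) :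
    M.cfgAt X' Z' w j = M.cfgAt X Z w j := by
  induction j with
  | zero => rfl
  | succ j ih =>
    have hlt : ∀ i, i ≠ .input → ((M.cfgAt X Z w j).tape i).number < 2 ^ s := fun i hi =>
      (M.cfgAt_within X Z w j hi).number_lt.trans_le
        (Nat.pow_le_pow_right (by norm_num) (by omega))
    rw [cfgAt_succ, cfgAt_succ, ih (by omega)]
    rcases hi : M.instr (M.cfgAt X Z w j).state with _ | f | ⟨_ | _, g⟩
    · simp [step, hi]
    · simp [step, hi]
    · simp only [step, hi]
      rw [hX _ (hlt _ (by simp))]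
    · simp only [step, hi]
      rw [hZ _ (hlt _ (by simp))]

/-- The rational number on the output tapes after `s n` steps on the input `X.take n`. -/
noncomputable def capital (M : OracleTM) (s : ℕ → ℕ) (X Z : BinSeq) (n : ℕ) : ℚ :=
  (((M.cfgAt X Z (X.take n) (s n)).tape .numerator).number : ℚ) /
    (((M.cfgAt X Z (X.take n) (s n)).tape .denominator).number : ℚ)

theorem capital_nonneg (M : OracleTM) (s : ℕ → ℕ) (X Z : BinSeq) (n : ℕ) :
    0 ≤ M.capital s X Z n := by
  unfold capital; positivity

/-- The machine behaves like a lookahead martingale as long as the first `n + 1` bits are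
concerned. -/
structure FairUpTo (M : OracleTM) (s : ℕ → ℕ) (n : ℕ) (Z : BinSeq) : Prop where
  halts : ∀ X : BinSeq, ∀ i ≤ n + 1, M.HaltsWithin X Z (X.take i) (s i)
  init : ∀ X : BinSeq, M.capital s X Z 0 = 1
  fair : ∀ X : BinSeq, ∀ i ≤ n, i ∉ revealed M X Z i →
    M.capital s (Function.update X i false) Z (i + 1) +
      M.capital s (Function.update X i true) Z (i + 1) = 2 * M.capital s X Z i
  frozen : ∀ X : BinSeq, ∀ i ≤ n, i ∈ revealed M X Z i →
    M.capital s X Z (i + 1) = M.capital s X Z i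

theorem FairUpTo.anti {M : OracleTM} {s : ℕ → ℕ} {m n : ℕ} {Z : BinSeq} (h : M.FairUpTo s n Z)
    (hmn : m ≤ n) : M.FairUpTo s m Z where
  halts X i hi := h.halts X i (by omega)
  init := h.init
  fair X i hi := h.fair X i (by omega)
  frozen X i hi := h.frozen X i (by omega)

theorem revealed_congr {M : OracleTM} {s : ℕ → ℕ} {n : ℕ} {X X' Z Z' : BinSeq}
    (hs : ∀ i ≤ n, M.HaltsWithin X Z (X.take i) (s i))
    (hZ : ∀ i ≤ n, ∀ p < 2 ^ s i, Z' p = Z p)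
    (hX : ∀ i < n, i ∉ revealed M X Z i → X'.take (i + 1) = X.take (i + 1) ∧
      ∀ p ∈ M.queried X Z (X.take (i + 1)), X' p = X p) {i : ℕ} (hi : i ≤ n) :
    revealed M X' Z' i = revealed M X Z i := by
  induction i with
  | zero => rfl
  | succ i ih =>
    rw [revealed, revealed, ih (by omega)]
    by_cases hr : i ∈ revealed M X Z i
    · rw [if_pos hr, if_pos hr]
    · obtain ⟨h1, h2⟩ := hX i (by omega) hr
      rw [if_neg hr, if_neg hr, h1, (hs _ hi).queried_congr h2 (hZ _ hi)]

theorem capital_congr_run {M : OracleTM} {s : ℕ → ℕ} {i : ℕ} {X X' Z Z' : BinSeq}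
    (hs : M.HaltsWithin X Z (X.take i) (s i)) (hZ : ∀ p < 2 ^ s i, Z' p = Z p)
    (ht : X'.take i = X.take i) (hX : ∀ p ∈ M.queried X Z (X.take i), X' p = X p) :
    M.capital s X' Z' i = M.capital s X Z i := by
  unfold capital
  rw [ht, hs.cfgAt_congr hX hZ]

/-- Halting within `s i` steps confines the external queries to positions below `2 ^ s i`. So the
condition concerns finitely many bits of `Z`, although it quantifies over all `X`. -/
theorem FairUpTo.congr {M : OracleTM} {s : ℕ → ℕ} {n : ℕ} {Z Z' : BinSeq} (h : M.FairUpTo s n Z)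
    (hZ : ∀ i ≤ n + 1, ∀ p < 2 ^ s i, Z' p = Z p) : M.FairUpTo s n Z' := by
  have hr : ∀ (X : BinSeq) (i : ℕ), i ≤ n + 1 → revealed M X Z' i = revealed M X Z i :=
    fun X i hi => revealed_congr (fun i hi => h.halts X i hi) hZ (fun _ _ _ => ⟨rfl, fun _ _ => rfl⟩) hi
  have hc : ∀ (X : BinSeq) (i : ℕ), i ≤ n + 1 → M.capital s X Z' i = M.capital s X Z i :=
    fun X i hi => capital_congr_run (h.halts X i hi) (hZ i hi) rfl fun _ _ => rfl
  refine ⟨fun X i hi => ?_, fun X => ?_, fun X i hi => ?_, fun X i hi => ?_⟩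
  · unfold HaltsWithin
    rw [(h.halts X i hi).cfgAt_congr (fun _ _ => rfl) (hZ i hi)]
    exact h.halts X i hi
  · rw [hc X 0 (by omega), h.init]
  · rw [hr X i (by omega), hc _ _ (by omega), hc _ _ (by omega), hc _ _ (by omega)]
    exact h.fair X i hi
  · rw [hr X i (by omega), hc _ _ (by omega), hc _ _ (by omega)]
    exact h.frozen X i hi

/-- Changing `X` only at positions that have not been seen does not change the history. -/
theorem FairUpTo.history_congr {M : OracleTM} {s : ℕ → ℕ} {n m : ℕ} {X X' Z Z' : BinSeq}
    (h : M.FairUpTo s n Z) (hZ : ∀ i ≤ n + 1, ∀ p < 2 ^ s i, Z' p = Z p) (hm : m ≤ n + 1)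
    (hX : ∀ i < m, i ∉ revealed M X Z i → X'.take (i + 1) = X.take (i + 1) ∧
      ∀ p ∈ M.queried X Z (X.take (i + 1)), X' p = X p) {i : ℕ} (hi : i ≤ m) :
    revealed M X' Z' i = revealed M X Z i ∧ M.capital s X' Z' i = M.capital s X Z i := by
  have hr : ∀ i ≤ m, revealed M X' Z' i = revealed M X Z i := fun i hi =>
    revealed_congr (fun i hi => h.halts X i (by omega)) (fun i hi => hZ i (by omega)) hX hi
  refine ⟨hr i hi, ?_⟩
  have h' := h.congr hZ
  induction i with
  | zero => rw [h'.init, h.init]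
  | succ i ih =>
    by_cases hri : i ∈ revealed M X Z i
    -- Where betting is forbidden, the run may query positions that are never recorded and at which
    -- `X'` may differ from `X`. Its output is therefore traced back to the previous capital and not
    -- compared directly.
    · rw [h.frozen X i (by omega) hri, h'.frozen X' i (by omega) (by rwa [hr i (by omega)]),
        ih (by omega)]
    · obtain ⟨h1, h2⟩ := hX i (by omega) hri
      exact capital_congr_run (h.halts X _ (by omega)) (hZ _ (by omega)) h1 h2

theorem _root_.BinSeq.take_congr {X X' : BinSeq} {n : ℕ} (h : ∀ p < n, X' p = X p) :
    X'.take n = X.take n :=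
  List.map_congr_left fun p hp => h p (List.mem_range.1 hp)

theorem revealed_mono (M : OracleTM) (X Z : BinSeq) : Monotone (revealed M X Z) := by
  refine monotone_nat_of_le_succ fun n => ?_
  rw [revealed]
  split_ifs
  · exact le_rfl
  · exact Set.subset_union_left

/-- Every position queried for a permitted bet before time `n` belongs to `revealed M X Z n`. If `n`
does not, then none of these runs has looked at bit `n`, and their inputs are too short to contain
it. -/
theorem FairUpTo.flip {M : OracleTM} {s : ℕ → ℕ} {n : ℕ} {X X' Z Z' : BinSeq}
    (h : M.FairUpTo s n Z) (hZ : ∀ i ≤ n + 1, ∀ p < 2 ^ s i, Z' p = Z p)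
    (hn : n ∉ revealed M X Z n) (hX : ∀ p, p ≠ n → X' p = X p) {i : ℕ} (hi : i ≤ n) :
    revealed M X' Z' i = revealed M X Z i ∧ M.capital s X' Z' i = M.capital s X Z i := by
  refine h.history_congr hZ (Nat.le_succ n) (fun i hi hri => ⟨?_, fun p hp => hX p ?_⟩) hi
  · exact BinSeq.take_congr fun p hp => hX p (by omega)
  · rintro rfl
    refine hn (M.revealed_mono X Z hi ?_)
    rw [revealed, if_neg hri]
    exact Or.inr hp

/-- One of the two sequences in the fairness condition is `X` itself. The flipped one may come with
another external oracle, since only the visible part of it matters. -/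
theorem FairUpTo.capital_add_capital_flip {M : OracleTM} {s : ℕ → ℕ} {n : ℕ} {X Z Z' : BinSeq}
    (h : M.FairUpTo s n Z) (hZ : ∀ i ≤ n + 1, ∀ p < 2 ^ s i, Z' p = Z p)
    (hn : n ∉ revealed M X Z n) :
    M.capital s X Z (n + 1) + M.capital s (Function.update X n (!X n)) Z' (n + 1) =
      2 * M.capital s X Z n := by
  have h1 : M.capital s (Function.update X n (!X n)) Z' (n + 1) =
      M.capital s (Function.update X n (!X n)) Z (n + 1) :=
    capital_congr_run (h.halts _ _ le_rfl) (hZ _ le_rfl) rfl fun _ _ => rfl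
  rw [h1, ← h.fair X n le_rfl hn]
  have h2 : Function.update X n (X n) = X := Function.update_eq_self _ _
  cases hb : X n
  · rw [hb] at h2
    rw [h2, Bool.not_false]
  · rw [hb] at h2
    rw [h2, Bool.not_true, add_comm]

/-- A fair bet with nonnegative outcomes can at most double the capital. This bounds the start of a
game that begins at a later time `n₀`. -/
theorem FairUpTo.capital_le {M : OracleTM} {s : ℕ → ℕ} {n : ℕ} {Z : BinSeq}
    (h : M.FairUpTo s n Z) (X : BinSeq) {i : ℕ} (hi : i ≤ n + 1) : M.capital s X Z i ≤ 2 ^ i := by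
  induction i with
  | zero => rw [h.init, pow_zero]
  | succ i ih =>
    have ih := ih (by omega)
    by_cases hr : i ∈ revealed M X Z i
    · rw [h.frozen X i (by omega) hr]
      exact ih.trans (pow_le_pow_right₀ (by norm_num) (Nat.le_succ i))
    · have h1 := (h.anti (by omega : i ≤ n)).capital_add_capital_flip (Z' := Z)
        (fun _ _ _ _ => rfl) hr
      have h2 := M.capital_nonneg s (Function.update X i (!X i)) Z (i + 1)
      rw [pow_succ]
      linarith

end OracleTM

/-- Once the time constant is fixed, `d` is replaced by `capital`, which makes sense for all
oracles, including those relative to which the machine is no martingale. -/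
theorem IsLookaheadMartingale.fairUpTo {t : ℕ → ℕ} {Z : BinSeq} {M : OracleTM}
    {d : BinSeq → ℕ → ℚ} (h : IsLookaheadMartingale t Z M d) {c : ℕ}
    (hc : ∀ (X : BinSeq) (n : ℕ), M.OutputsRatWithin X Z (X.take n) (c * t n + c) (d X n))
    (n : ℕ) : M.FairUpTo (fun n => c * t n + c) n Z := by
  have hcap : ∀ X n, M.capital (fun n => c * t n + c) X Z n = d X n := fun X n =>
    (hc X n).2.2.symm
  refine ⟨fun X i _ => (hc X i).1, fun X => ?_, fun X i _ hi => ?_, fun X i _ hi => ?_⟩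
  · rw [hcap, h.init]
  · rw [hcap, hcap, hcap, h.fair X i hi]
  · rw [hcap, hcap, h.frozen X i hi]

theorem SucceedsOn.exists_le {d : BinSeq → ℕ → ℚ} {X : BinSeq} (h : SucceedsOn d X) (C n₀ : ℕ) :
    ∃ n ≥ n₀, (C : ℚ) ≤ d X n := by
  by_contra! hlt
  have : limsup (fun n : ℕ => (((d X n : ℚ) : ℝ) : EReal)) atTop ≤ ((C : ℝ) : EReal) := by
    refine limsup_le_of_le (h := ?_)
    filter_upwards [eventually_ge_atTop n₀] with n hn
    exact_mod_cast (hlt n hn).le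
  rw [show limsup (fun n : ℕ => (((d X n : ℚ) : ℝ) : EReal)) atTop = ⊤ from h, top_le_iff] at this
  exact EReal.coe_ne_top _ this

/-! ### Almost all sequences are random -/

open MeasureTheory ENNReal in
/-- A function of two binary sequences that depends on finitely many bits only is measurable. -/
theorem measurable_of_forall_lt {α : Type*} [MeasurableSpace α] (f : BinSeq → BinSeq → α) (K : ℕ)
    (hf : ∀ X X' Z Z' : BinSeq, (∀ p < K, X' p = X p) → (∀ p < K, Z' p = Z p) →
      f X' Z' = f X Z) : Measurable fun q : BinSeq × BinSeq => f q.1 q.2 := by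
  let r : BinSeq → (Fin K → Bool) := fun X p => X p
  let e : (Fin K → Bool) → BinSeq := fun u p => if h : p < K then u ⟨p, h⟩ else false
  have hr : Measurable r := measurable_pi_lambda _ fun p => measurable_pi_apply _
  have : (fun q : BinSeq × BinSeq => f q.1 q.2) =
      (fun u : (Fin K → Bool) × (Fin K → Bool) => f (e u.1) (e u.2)) ∘
        fun q => (r q.1, r q.2) := by
    funext q
    refine hf _ _ _ _ ?_ ?_ <;> intro p hp <;> simp [e, r, hp]
  rw [this]
  exact (measurable_of_finite _).comp ((hr.comp measurable_fst).prodMk (hr.comp measurable_snd))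

namespace OracleTM

/-- A common bound for the lengths of the inputs and for the reach of the queries in the first runs.
-/
theorem exists_bound (s : ℕ → ℕ) (n : ℕ) : ∃ K : ℕ, ∀ i ≤ n + 1, 2 ^ s i ≤ K ∧ i ≤ K := by
  refine ⟨∑ j ∈ Finset.range (n + 2), (2 ^ s j + j), fun i hi => ?_⟩
  have : 2 ^ s i + i ≤ ∑ j ∈ Finset.range (n + 2), (2 ^ s j + j) :=
    Finset.single_le_sum (f := fun j => 2 ^ s j + j) (fun _ _ => Nat.zero_le _)
      (Finset.mem_range.2 (by omega))
  exact ⟨(Nat.le_add_right _ _).trans this, (Nat.le_add_left _ _).trans this⟩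

open MeasureTheory ENNReal in
theorem measurable_ofReal_capital (M : OracleTM) (s : ℕ → ℕ) (n : ℕ) :
    Measurable fun q : BinSeq × BinSeq => ENNReal.ofReal ((M.capital s q.1 q.2 n : ℚ) : ℝ) := by
  obtain ⟨K, hK⟩ := exists_bound s n
  refine measurable_of_forall_lt (fun x z => ENNReal.ofReal ((M.capital s x z n : ℚ) : ℝ)) K ?_
  intro x x' z z' hx hz
  have hKn := hK n (Nat.le_succ n)
  simp only [capital]
  rw [BinSeq.take_congr fun p hp => hx p (hp.trans_le hKn.2),
    cfgAt_congr_of_lt (fun p hp => hx p (hp.trans_le hKn.1))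
      (fun p hp => hz p (hp.trans_le hKn.1)) le_rfl]

open MeasureTheory ENNReal in
theorem measurable_ofReal_capital_comp (M : OracleTM) (s : ℕ → ℕ) (n : ℕ) {Ω : Type*}
    [MeasurableSpace Ω] {X Z : Ω → BinSeq} (mX : Measurable X) (mZ : Measurable Z) :
    Measurable fun ω => ENNReal.ofReal ((M.capital s (X ω) (Z ω) n : ℚ) : ℝ) := by
  have h := (M.measurable_ofReal_capital s n).comp (mX.prodMk mZ)
  simpa only [Function.comp_def] using h

theorem measurableSet_fairUpTo (M : OracleTM) (s : ℕ → ℕ) (n : ℕ) :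
    MeasurableSet {q : BinSeq × BinSeq | M.FairUpTo s n q.2} := by
  obtain ⟨K, hK⟩ := exists_bound s n
  refine measurableSet_setOfPred.2 (measurable_of_forall_lt (fun _ z => M.FairUpTo s n z) K ?_)
  intro _ _ z z' _ hz
  exact propext ⟨fun h => h.congr fun i hi p hp => (hz p (hp.trans_le (hK i hi).1)).symm,
    fun h => h.congr fun i hi p hp => hz p (hp.trans_le (hK i hi).1)⟩

/-- The condition on the revealed set is taken only together with `FairUpTo`: a run that does not
halt could make the set of queried positions depend on infinitely many bits. -/
theorem measurableSet_fairUpTo_inter (M : OracleTM) (s : ℕ → ℕ) (n : ℕ) :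
    MeasurableSet {q : BinSeq × BinSeq | M.FairUpTo s n q.2 ∧ n ∉ revealed M q.1 q.2 n} := by
  obtain ⟨K, hK⟩ := exists_bound s n
  refine measurableSet_setOfPred.2 (measurable_of_forall_lt
    (fun x z => M.FairUpTo s n z ∧ n ∉ revealed M x z n) K ?_)
  have key : ∀ x x' z z' : BinSeq, (∀ p < K, x' p = x p) → (∀ p < K, z' p = z p) →
      M.FairUpTo s n z ∧ n ∉ revealed M x z n →
      M.FairUpTo s n z' ∧ n ∉ revealed M x' z' n := by
    rintro x x' z z' hx hz ⟨h, hr⟩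
    have hz' : ∀ i ≤ n + 1, ∀ p < 2 ^ s i, z' p = z p := fun i hi p hp =>
      hz p (hp.trans_le (hK i hi).1)
    refine ⟨h.congr hz', ?_⟩
    rwa [(h.history_congr hz' (Nat.le_succ n) (fun i hi _ => ⟨?_, fun p hp => hx p ?_⟩) le_rfl).1]
    · exact BinSeq.take_congr fun p hp => hx p (hp.trans_le (hK (i + 1) (by omega)).2)
    · exact ((h.halts x (i + 1) (by omega)).queried_lt hp).trans_le (hK (i + 1) (by omega)).1
  intro x x' z z' hx hz
  exact propext ⟨key _ _ _ _ (fun p hp => (hx p hp).symm) fun p hp => (hz p hp).symm,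
    key _ _ _ _ hx hz⟩

open MeasureTheory ENNReal in
/-- The capital of a machine along a random sequence is a fair process. -/
theorem isFairGame (M : OracleTM) (s : ℕ → ℕ) {Ω : Type*} [MeasurableSpace Ω] {μ : Measure Ω}
    {X Z : Ω → BinSeq} (mX : Measurable X) (mZ : Measurable Z)
    {φ : ℕ → Ω → Ω} (hφ : ∀ n, MeasurePreserving (φ n) μ μ) (hinv : ∀ n, (φ n).Involutive)
    (hX : ∀ n ω, X (φ n ω) = Function.update (X ω) n (!X ω n)) {n₀ : ℕ}
    (hZ : ∀ n ≥ n₀, ∀ ω, ∀ i ≤ n + 1, ∀ p < 2 ^ s i, Z (φ n ω) p = Z ω p) :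
    IsFairGame μ (fun n ω => ENNReal.ofReal ((M.capital s (X ω) (Z ω) n : ℚ) : ℝ))
      (fun n => {ω | M.FairUpTo s n (Z ω)}) (fun n => {ω | n ∉ revealed M (X ω) (Z ω) n}) φ n₀
      (ENNReal.ofReal ((2 ^ n₀ : ℚ) : ℝ)) where
  measurable n := M.measurable_ofReal_capital_comp s n mX mZ
  measurableSet_good n :=
    have h := measurableSet_preimage (mX.prodMk mZ) (M.measurableSet_fairUpTo s n)
    h
  measurableSet_inter n :=
    have h := measurableSet_preimage (mX.prodMk mZ) (M.measurableSet_fairUpTo_inter s n)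
    h
  measurePreserving := hφ
  involutive := hinv
  anti := by
    intro m n hmn ω hω
    exact FairUpTo.anti hω hmn
  initial := by
    intro ω hω
    have h : M.capital s (X ω) (Z ω) n₀ ≤ 2 ^ n₀ :=
      FairUpTo.capital_le hω (X ω) (Nat.le_succ _)
    exact ENNReal.ofReal_le_ofReal (Rat.cast_le.2 h)
  frozen := by
    intro n _ ω hG hS
    have h : M.capital s (X ω) (Z ω) (n + 1) = M.capital s (X ω) (Z ω) n :=
      FairUpTo.frozen hG (X ω) n le_rfl (not_not.1 hS)
    simp only [h]
  mem := by
    rintro n hn ω ⟨hG, hS⟩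
    have hz := hZ n hn ω
    refine ⟨FairUpTo.congr hG hz, ?_⟩
    have := (FairUpTo.flip hG hz hS
      (X' := X (φ n ω)) (fun p hp => by rw [hX, Function.update_of_ne hp]) le_rfl).1
    change n ∉ revealed M (X (φ n ω)) (Z (φ n ω)) n
    rw [this]
    exact hS
  past := by
    rintro n hn ω ⟨hG, hS⟩ i hi _
    have := (FairUpTo.flip hG (hZ n hn ω) hS
      (X' := X (φ n ω)) (fun p hp => by rw [hX, Function.update_of_ne hp]) hi).2
    simp only [this]
  fair := by
    rintro n hn ω ⟨hG, hS⟩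
    have := FairUpTo.capital_add_capital_flip hG (hZ n hn ω) hS
    rw [← hX] at this
    have hcast := congrArg (fun q : ℚ => ENNReal.ofReal (q : ℝ)) this
    simp only [Rat.cast_add, Rat.cast_mul, Rat.cast_ofNat] at hcast
    rw [ENNReal.ofReal_add (by exact_mod_cast M.capital_nonneg _ _ _ _)
      (by exact_mod_cast M.capital_nonneg _ _ _ _), ENNReal.ofReal_mul (by norm_num),
      ENNReal.ofReal_ofNat] at hcast
    exact hcast

end OracleTM

open MeasureTheory ENNReal in
/-- If flipping the bits of `X` can be done without disturbing the part of `Z` that can be seen,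
then `X` is almost surely random relative to `Z`. -/
theorem measure_lookaheadNonrandomRel {Ω : Type*} [MeasurableSpace Ω] {μ : Measure Ω}
    [IsProbabilityMeasure μ] {X Z : Ω → BinSeq} (mX : Measurable X) (mZ : Measurable Z)
    {φ : ℕ → Ω → Ω} (hφ : ∀ n, MeasurePreserving (φ n) μ μ) (hinv : ∀ n, (φ n).Involutive)
    (hX : ∀ n ω, X (φ n ω) = Function.update (X ω) n (!X ω n)) {t : ℕ → ℕ}
    (hZ : ∀ c : ℕ, ∀ᶠ n in atTop, ∀ ω, ∀ i ≤ n + 1, ∀ p < 2 ^ (c * t i + c),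
      Z (φ n ω) p = Z ω p) :
    μ {ω | LookaheadNonrandomRel t (Z ω) (X ω)} = 0 := by
  -- The game for the constant `c` begins at `n₀ c`, from where on the flips leave the visible part
  -- of `Z` alone.
  choose n₀ hn₀ using fun c => eventually_atTop.1 (hZ c)
  let D : OracleTM → ℕ → ℕ → Ω → ℝ≥0∞ := fun M c n ω =>
    ENNReal.ofReal ((M.capital (fun n => c * t n + c) (X ω) (Z ω) n : ℚ) : ℝ)
  -- One game for each numbered machine and each time constant; a countable union.
  refine measure_mono_null (t := ⋃ (e : MachineCode) (c : ℕ),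
    {ω | (∀ n, ω ∈ {ω | e.machine.FairUpTo (fun n => c * t n + c) n (Z ω)}) ∧
      ∀ C : ℕ, ∃ n ≥ n₀ c, (C : ℝ≥0∞) ≤ D e.machine c n ω}) ?_ ?_
  · intro ω hω
    obtain ⟨e, d, h, hd⟩ := (lookaheadNonrandomRel_iff_exists_code _ _ _).1 hω
    obtain ⟨c, hc⟩ := h.computes
    refine Set.mem_iUnion₂.2 ⟨e, c, fun n => h.fairUpTo hc n, fun C => ?_⟩
    obtain ⟨n, hn, hCn⟩ := hd.exists_le C (n₀ c)
    refine ⟨n, hn, ?_⟩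
    have hcap : e.machine.capital (fun n => c * t n + c) (X ω) (Z ω) n = d (X ω) n :=
      ((hc (X ω) n).2.2).symm
    simp only [D, hcap]
    rw [← ENNReal.ofReal_natCast]
    exact ENNReal.ofReal_le_ofReal (by exact_mod_cast hCn)
  · exact measure_iUnion_null fun e => measure_iUnion_null fun c =>
      (e.machine.isFairGame _ mX mZ hφ hinv hX (hn₀ c)).measure_unbounded ENNReal.ofReal_ne_top

/-! ### Random sequences with planted dependencies -/

section Coins

open MeasureTheory

/-- A fair coin. -/
noncomputable def coin : Measure Bool := (PMF.uniformOfFintype Bool).toMeasure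

instance : IsProbabilityMeasure coin := by unfold coin; infer_instance

theorem measurePreserving_not_coin : MeasurePreserving (fun b => !b) coin coin := by
  refine ⟨measurable_of_finite _, ?_⟩
  refine Measure.ext_of_singleton fun b => ?_
  rw [Measure.map_apply (measurable_of_finite _) (measurableSet_singleton b)]
  have : (fun b => !b) ⁻¹' {b} = {!b} := by
    ext c; cases b <;> cases c <;> simp
  rw [this, coin, PMF.toMeasure_apply_singleton _ _ (measurableSet_singleton _),
    PMF.toMeasure_apply_singleton _ _ (measurableSet_singleton _)]
  simp

/-- Independent fair coins. -/
noncomputable def coins (ι : Type*) : Measure (ι → Bool) := Measure.infinitePi fun _ => coin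

instance (ι : Type*) : IsProbabilityMeasure (coins ι) := by unfold coins; infer_instance

/-- Flip one coin. -/
def flipAt {ι : Type*} [DecidableEq ι] (j : ι) (ω : ι → Bool) : ι → Bool :=
  Function.update ω j (!ω j)

theorem flipAt_involutive {ι : Type*} [DecidableEq ι] (j : ι) : (flipAt j).Involutive := by
  intro ω
  simp [flipAt]

/-- The flip acts coordinatewise, by negation on one factor and by the identity on the others, and
each of these maps preserves the coin. -/
theorem measurePreserving_flipAt {ι : Type*} [DecidableEq ι] (j : ι) :
    MeasurePreserving (flipAt j) (coins ι) (coins ι) := by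
  have h : flipAt j = fun (ω : ι → Bool) i => (if i = j then (fun b => !b) else id) (ω i) := by
    funext ω i
    by_cases h : i = j
    · subst h; simp [flipAt]
    · simp [flipAt, h]
  have hm : ∀ i, Measurable (if i = j then (fun b : Bool => !b) else id) := fun _ =>
    measurable_of_finite _
  refine ⟨by rw [h]; exact measurable_pi_lambda _ fun i => (hm i).comp (measurable_pi_apply i), ?_⟩
  rw [h, coins, Measure.infinitePi_map_pi _ hm]
  congr
  funext i
  by_cases hi : i = j
  · simp only [hi, if_true]
    exact measurePreserving_not_coin.map_eq
  · simp only [hi, if_false]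
    exact Measure.map_id

open Classical in
/-- The sequence which repeats the bit of the first family of coins at the position `k` in the
position `g k`, and consists of the second family of coins elsewhere. -/
noncomputable def planted (g : ℕ → ℕ) (ω : ℕ ⊕ ℕ → Bool) : BinSeq := fun n =>
  if h : ∃ k, g k = n then ω (.inl h.choose) else ω (.inr n)

theorem planted_apply {g : ℕ → ℕ} (hg : Function.Injective g) (ω : ℕ ⊕ ℕ → Bool) (k : ℕ) :
    planted g ω (g k) = ω (.inl k) := by
  have h : ∃ k', g k' = g k := ⟨k, rfl⟩
  rw [planted, dif_pos h, hg h.choose_spec]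

theorem planted_flipAt_of_ne {g : ℕ → ℕ} (hg : Function.Injective g) (ω : ℕ ⊕ ℕ → Bool) {k n : ℕ}
    (hn : n ≠ g k) : planted g (flipAt (.inl k) ω) n = planted g ω n := by
  by_cases h : ∃ k', g k' = n
  · obtain ⟨k', rfl⟩ := h
    rw [planted_apply hg, planted_apply hg, flipAt, Function.update_of_ne]
    rintro h
    rw [Sum.inl.injEq] at h
    exact hn (by rw [h])
  · rw [planted, planted, dif_neg h, dif_neg h, flipAt, Function.update_of_ne (by simp)]

open Classical in
/-- The coin that determines a bit of the planted sequence. -/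
noncomputable def plantedIndex (g : ℕ → ℕ) (n : ℕ) : ℕ ⊕ ℕ :=
  if h : ∃ k, g k = n then .inl h.choose else .inr n

theorem planted_eq (g : ℕ → ℕ) (ω : ℕ ⊕ ℕ → Bool) (n : ℕ) :
    planted g ω n = ω (plantedIndex g n) := by
  unfold planted plantedIndex
  split_ifs <;> rfl

/-- Distinct bits of the planted sequence are distinct coins (the coins `.inr (g k)` remain unused),
so flipping one of these coins flips exactly one bit. -/
theorem plantedIndex_injective (g : ℕ → ℕ) : Function.Injective (plantedIndex g) := by
  intro m n h
  unfold plantedIndex at h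
  split_ifs at h with hm hn hn
  · rw [← hm.choose_spec, ← hn.choose_spec, Sum.inl.inj h]
  · exact Sum.inr.inj h

/-- If the position `g k` is out of reach of the computations on the first `k + 1` bits, then the
bits at the positions `k` of `A` can be copied to the positions `g k` of `B`, without making `A`
nonrandom relative to `B`. -/
theorem exists_random_planted {t g : ℕ → ℕ} (hg : Function.Injective g)
    (h : ∀ c : ℕ, ∀ᶠ k in atTop, ∀ i ≤ k + 1, 2 ^ (c * t i + c) ≤ g k) :
    ∃ A B : BinSeq, LookaheadRandom t B ∧ LookaheadRandomRel t B A ∧ ∀ k, B (g k) = A k := by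
  have mB : Measurable (planted g) := by
    refine measurable_pi_lambda _ fun n => ?_
    simp only [planted_eq]
    exact measurable_pi_apply _
  have mA : Measurable fun (ω : ℕ ⊕ ℕ → Bool) (n : ℕ) => ω (.inl n) :=
    measurable_pi_lambda _ fun n => measurable_pi_apply _
  -- The external oracle is constant here, so there is nothing that a flip could disturb.
  have hB := measure_lookaheadNonrandomRel (μ := coins (ℕ ⊕ ℕ)) mB
    (measurable_const (a := zeroSeq)) (φ := fun n => flipAt (plantedIndex g n))
    (fun n => measurePreserving_flipAt _) (fun n => flipAt_involutive _) (t := t)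
    (by
      intro n ω
      funext p
      rw [planted_eq]
      by_cases hp : p = n
      · subst hp
        simp [flipAt, planted_eq]
      · rw [Function.update_of_ne hp, flipAt,
          Function.update_of_ne fun h => hp (plantedIndex_injective g h), planted_eq])
    (fun c => Eventually.of_forall fun n ω i _ p _ => rfl)
  -- Flipping the coin `.inl n` also flips the copy at `g n`; by hypothesis that position is too
  -- large to be queried in the runs on the first `n + 1` bits.
  have hA := measure_lookaheadNonrandomRel (μ := coins (ℕ ⊕ ℕ)) mA mB
    (φ := fun n => flipAt (.inl n))
    (fun n => measurePreserving_flipAt _) (fun n => flipAt_involutive _) (t := t)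
    (by
      intro n ω
      funext p
      by_cases hp : p = n
      · subst hp
        simp [flipAt]
      · rw [Function.update_of_ne hp, flipAt, Function.update_of_ne (by simpa using hp)])
    (by
      intro c
      filter_upwards [h c] with n hn ω i hi p hp
      exact planted_flipAt_of_ne hg ω (hp.trans_le (hn i hi)).ne)
  have hAB := measure_union_null hA hB
  obtain ⟨ω, hω⟩ : ∃ ω, ω ∉ {ω | LookaheadNonrandomRel t (planted g ω) fun n => ω (.inl n)} ∪
      {ω | LookaheadNonrandomRel t zeroSeq (planted g ω)} := by
    by_contra! hall
    rw [Set.eq_univ_of_forall hall, measure_univ] at hAB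
    exact one_ne_zero hAB
  exact ⟨fun n => ω (.inl n), planted g ω, fun hn => hω (Or.inr hn), fun hn => hω (Or.inl hn),
    fun k => planted_apply hg ω k⟩

end Coins

/-! ### Tapes that hold a word -/

namespace TMTape

/-- The tape that holds the word `w` from cell `0` on, with the head on cell `h`. -/
def wordAt (w : List Bool) (h : ℤ) : TMTape := ⟨(ofWord w).cells, h⟩

@[simp]
theorem read_wordAt (w : List Bool) (n : ℕ) : (wordAt w n).read = w[n]? := by
  simp [wordAt, ofWord, read]

theorem read_wordAt_of_neg (w : List Bool) {h : ℤ} (hh : h < 0) : (wordAt w h).read = none := by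
  simp [wordAt, ofWord, read, not_le.2 hh]

@[simp]
theorem write_read (T : TMTape) : T.write T.read = T := by
  simp [write, read]

theorem write_wordAt (w : List Bool) (b : Bool) :
    (wordAt w w.length).write (some b) = wordAt (w ++ [b]) w.length := by
  simp only [wordAt, write, mk.injEq, and_true]
  funext z
  by_cases hz : z = w.length
  · subst hz
    simp [ofWord]
  · rw [Function.update_of_ne hz]
    simp only [ofWord]
    split_ifs with h0
    · obtain ⟨n, rfl⟩ := Int.eq_ofNat_of_zero_le h0
      have hn : n ≠ w.length := by exact_mod_cast hz
      simp only [Int.toNat_natCast]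
      rcases lt_or_gt_of_ne hn with h | h
      · rw [List.getElem?_append_left h]
      · rw [List.getElem?_eq_none h.le, List.getElem?_eq_none (by simp; omega)]
    · rfl

@[simp]
theorem move_left_wordAt (w : List Bool) (h : ℤ) : (wordAt w h).move .left = wordAt w (h - 1) := rfl

@[simp]
theorem move_stay (T : TMTape) : T.move .stay = T := rfl

@[simp]
theorem move_right_wordAt (w : List Bool) (h : ℤ) :
    (wordAt w h).move .right = wordAt w (h + 1) := rfl

theorem word_wordAt (w : List Bool) (h : ℤ) : (wordAt w h).word = w := by
  have hc : ∀ n : ℕ, (wordAt w h).cells n = w[n]? := by intro n; simp [wordAt, ofWord]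
  have hex : ∃ n : ℕ, (wordAt w h).cells n = none := ⟨w.length, by simp [hc]⟩
  classical
  have hfind : Nat.find hex = w.length := by
    rw [Nat.find_eq_iff]
    exact ⟨by simp [hc], fun n hn => by simp [hc, hn]⟩
  have : (wordAt w h).word =
      (List.range (Nat.find hex)).map (fun i : ℕ => ((wordAt w h).cells i).getD false) := by
    simp only [word, dif_pos hex]
  rw [this, hfind]
  refine List.ext_getElem (by simp) fun i h1 h2 => ?_
  simp [hc, h2]

theorem number_wordAt (w : List Bool) (h : ℤ) :
    (wordAt w h).number = Nat.ofDigits 2 (w.map Bool.toNat) := by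
  rw [number, word_wordAt]

end TMTape

theorem Nat.ofDigits_replicate_false (k : ℕ) :
    Nat.ofDigits 2 ((List.replicate k false).map Bool.toNat) = 0 := by
  induction k with
  | zero => rfl
  | succ k ih => simp [List.replicate_succ, Nat.ofDigits_cons]

/-! ### Autonomous machines and the martingales they drive -/

/-- A machine that runs without input and without end. In some states it demands a check, and in
some states it demands that a position be advanced. -/
structure Clockwork : Type 1 where
  Tape : Type
  State : Type
  finTape : Finite Tape
  finState : Finite State
  start : State
  next : State → (Tape → Option Bool) → State × (Tape → Option Bool × HeadMove)
  check : State → Bool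
  advance : State → Bool

namespace Clockwork

/-- Configurations. The position counts how often it was advanced. -/
structure Cfg (W : Clockwork) : Type where
  state : W.State
  tape : W.Tape → TMTape
  pos : ℕ

/-- One step. -/
def step (W : Clockwork) (c : W.Cfg) : W.Cfg where
  state := (W.next c.state fun a => (c.tape a).read).1
  tape a := ((c.tape a).write ((W.next c.state fun a => (c.tape a).read).2 a).1).move
    ((W.next c.state fun a => (c.tape a).read).2 a).2
  pos := c.pos + (W.advance c.state).toNat

/-- The initial configuration. -/
def init (W : Clockwork) : W.Cfg := ⟨W.start, fun _ => TMTape.ofWord [], 0⟩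

/-- The configuration after `n` steps. -/
def cfgAt (W : Clockwork) (n : ℕ) : W.Cfg := W.step^[n] W.init

theorem cfgAt_succ (W : Clockwork) (n : ℕ) : W.cfgAt (n + 1) = W.step (W.cfgAt n) :=
  Function.iterate_succ_apply' _ _ _

theorem pos_cfgAt_le (W : Clockwork) (n : ℕ) : (W.cfgAt n).pos ≤ n := by
  induction n with
  | zero => exact le_rfl
  | succ n ih =>
    rw [cfgAt_succ]
    have := Bool.toNat_le (W.advance (W.cfgAt n).state)
    simp only [step]
    omega

/-- Whether a check is demanded in the `n`-th step. -/
def checks (W : Clockwork) (n : ℕ) : Bool := W.check (W.cfgAt n).state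

/-- Whether all checks up to the `n`-th step are passed by `X`. -/
def alive (W : Clockwork) (X : BinSeq) : ℕ → Bool
  | 0 => true
  | n + 1 => W.alive X n && (!W.checks n || X (W.cfgAt n).pos == X n)

/-- The number of checks up to the `n`-th step. -/
def count (W : Clockwork) : ℕ → ℕ
  | 0 => 0
  | n + 1 => W.count n + (W.checks n).toNat

/-- The capital of the gambler who always bets on the check being passed. -/
def capital (W : Clockwork) (X : BinSeq) (n : ℕ) : ℚ := if W.alive X n then 2 ^ W.count n else 0

/-- At a check the whole capital is staked on one value of bit `n`, which is determined by an
earlier bit: it doubles for that value and is lost for the other. Whether the gambler is still alive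
depends on the bits below `n` only. -/
theorem capital_fair (W : Clockwork) (hW : ∀ n, W.checks n = true → (W.cfgAt n).pos < n)
    (X : BinSeq) (n : ℕ) :
    W.capital (Function.update X n false) (n + 1) + W.capital (Function.update X n true) (n + 1) =
      2 * W.capital X n := by
  have hal : ∀ b, ∀ m ≤ n, W.alive (Function.update X n b) m = W.alive X m := by
    intro b m hm
    induction m with
    | zero => rfl
    | succ m ih =>
      have := W.pos_cfgAt_le m
      rw [alive, alive, ih (by omega), Function.update_of_ne (by omega),
        Function.update_of_ne (by omega)]
  have h1 : ∀ b, W.capital (Function.update X n b) (n + 1) =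
      if W.alive X n && (!W.checks n || X (W.cfgAt n).pos == b) then
        2 ^ (W.count n + (W.checks n).toNat) else 0 := by
    intro b
    rw [capital, alive, hal b n le_rfl, Function.update_self, count]
    cases hc : W.checks n
    · simp
    · rw [Function.update_of_ne (hW n hc).ne]
  rw [h1, h1, capital]
  cases W.alive X n <;> cases W.checks n <;> cases X (W.cfgAt n).pos <;> simp [pow_succ] <;> ring

/-! ### A linear-time machine that computes this capital -/

/-- The states of the betting machine. -/
inductive BetState (Q : Type) : Type
  | copy
  | rewind
  | main (q : Q) (alive : Bool)
  | halt

instance (Q : Type) [Finite Q] : Finite (BetState Q) :=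
  Finite.of_surjective (α := Option (Option (Option (Q × Bool))))
    (fun
      | none => .copy
      | some none => .rewind
      | some (some none) => .halt
      | some (some (some (q, b))) => .main q b)
    (by
      intro s
      cases s with
      | copy => exact ⟨none, rfl⟩
      | rewind => exact ⟨some none, rfl⟩
      | halt => exact ⟨some (some none), rfl⟩
      | main q b => exact ⟨some (some (some (q, b))), rfl⟩)

/-- The work tapes of the betting machine: the tapes of the clockwork, and a copy of the input. -/
noncomputable def tapeEquiv (W : Clockwork) : Option W.Tape ≃ Fin (Nat.card (Option W.Tape)) :=
  have := W.finTape
  Finite.equivFin _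

/-- A function on the tapes of the betting machine, from its values on the input tape, on the copy
of the input, on the numerator and the denominator tapes, on the query tapes and on the tapes of
the clockwork. -/
noncomputable def onTapes (W : Clockwork) {α : Type} (inp cpy num den query : α)
    (w : W.Tape → α) : TapeName (Nat.card (Option W.Tape)) → α
  | .input => inp
  | .lookaheadQuery => query
  | .externalQuery => query
  | .numerator => num
  | .denominator => den
  | .work i => (W.tapeEquiv.symm i).elim cpy w

/-- The machine that first copies its input and then, while it reads the copy, runs the clockwork
and performs the checks. -/
noncomputable def betMachine (W : Clockwork) : OracleTM where
  k := Nat.card (Option W.Tape)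
  Q := BetState W.State
  finQ := have := W.finState; inferInstance
  start := .copy
  instr
    | .copy => .act fun r =>
        let w := fun a => (r (.work (W.tapeEquiv (some a))), HeadMove.stay)
        let m := if (r .input).isSome then HeadMove.right else HeadMove.left
        (if (r .input).isSome then .copy else .rewind,
          W.onTapes (r .input, m) (r .input, m)
            (r .numerator, .stay) (r .denominator, .stay) (none, .stay) w)
    | .rewind => .act fun r =>
        let w := fun a => (r (.work (W.tapeEquiv (some a))), HeadMove.stay)
        let m := if (r .input).isSome then HeadMove.left else HeadMove.right
        (if (r .input).isSome then .rewind else .main W.start true,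
          W.onTapes (r .input, m) (r .input, m)
            (r .numerator, .stay) (r .denominator, .stay) (none, .stay) w)
    | .main q alive => .act fun r =>
        match r (.work (W.tapeEquiv none)) with
        | none =>
          (.halt, W.onTapes (r .input, .stay) (none, .stay)
            (if alive then some true else r .numerator, .stay) (some true, .stay) (none, .stay)
            fun a => (r (.work (W.tapeEquiv (some a))), HeadMove.stay))
        | some b =>
          let p := W.next q fun a => r (.work (W.tapeEquiv (some a)))
          (.main p.1 (alive && (!W.check q || r .input == some b)),
            W.onTapes (r .input, if W.advance q then .right else .stay) (some b, .right)
              (if W.check q then (some false, .right) else (r .numerator, .stay))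
              (r .denominator, .stay) (none, .stay) p.2)
    | .halt => .halt

/-- A configuration of the betting machine. -/
noncomputable def betCfg (W : Clockwork) (q : BetState W.State) (inp cpy num den : TMTape)
    (w : W.Tape → TMTape) : W.betMachine.Cfg :=
  ⟨q, W.onTapes inp cpy num den (TMTape.ofWord []) w⟩

theorem betMachine_step (W : Clockwork) (X Z : BinSeq) {q : BetState W.State}
    {inp cpy num den : TMTape} {w : W.Tape → TMTape}
    {f : (TapeName (Nat.card (Option W.Tape)) → Option Bool) →
      BetState W.State × (TapeName (Nat.card (Option W.Tape)) → Option Bool × HeadMove)}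
    (hf : W.betMachine.instr q = .act f) {q' : BetState W.State}
    {ainp acpy anum aden : Option Bool × HeadMove} {aw : W.Tape → Option Bool × HeadMove}
    (h : f (W.onTapes inp.read cpy.read num.read den.read none fun a => (w a).read) =
      (q', W.onTapes ainp acpy anum aden (none, .stay) aw)) :
    W.betMachine.step X Z (W.betCfg q inp cpy num den w) =
      W.betCfg q' ((inp.write ainp.1).move ainp.2) ((cpy.write acpy.1).move acpy.2)
        ((num.write anum.1).move anum.2) ((den.write aden.1).move aden.2)
        (fun a => ((w a).write (aw a).1).move (aw a).2) := by
  have hr : (fun i => ((W.betCfg q inp cpy num den w).tape i).read) =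
      W.onTapes inp.read cpy.read num.read den.read none fun a => (w a).read := by
    funext i
    cases i with
    | work i =>
      simp only [betCfg, onTapes]
      cases W.tapeEquiv.symm i <;> rfl
    | _ => rfl
  have hq : W.betMachine.instr (W.betCfg q inp cpy num den w).state = .act f := hf
  simp only [OracleTM.step, hq]
  rw [hr, h]
  simp only [betCfg]
  refine congrArg (OracleTM.Cfg.mk (M := W.betMachine) q') ?_
  funext i
  cases i with
  | work i =>
    simp only [onTapes]
    cases W.tapeEquiv.symm i <;> rfl
  | lookaheadQuery => exact TMTape.write_read (TMTape.ofWord [])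
  | externalQuery => exact TMTape.write_read (TMTape.ofWord [])
  | _ => rfl

@[simp]
theorem onTapes_input (W : Clockwork) {α : Type} (inp cpy num den query : α) (w : W.Tape → α) :
    W.onTapes inp cpy num den query w .input = inp := rfl

@[simp]
theorem onTapes_numerator (W : Clockwork) {α : Type} (inp cpy num den query : α)
    (w : W.Tape → α) : W.onTapes inp cpy num den query w .numerator = num := rfl

@[simp]
theorem onTapes_denominator (W : Clockwork) {α : Type} (inp cpy num den query : α)
    (w : W.Tape → α) : W.onTapes inp cpy num den query w .denominator = den := rfl

@[simp]
theorem onTapes_none (W : Clockwork) {α : Type} (inp cpy num den query : α)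
    (w : W.Tape → α) : W.onTapes inp cpy num den query w (.work (W.tapeEquiv none)) = cpy := by
  simp [onTapes]

@[simp]
theorem onTapes_some (W : Clockwork) {α : Type} (inp cpy num den query : α)
    (w : W.Tape → α) (a : W.Tape) :
    W.onTapes inp cpy num den query w (.work (W.tapeEquiv (some a))) = w a := by
  simp [onTapes]

open TMTape

theorem betMachine_copy (W : Clockwork) (X Z : BinSeq) (w : List Bool) {j : ℕ}
    (hj : j ≤ w.length) : W.betMachine.cfgAt X Z w j =
      W.betCfg .copy (wordAt w j) (wordAt (w.take j) j) (ofWord []) (ofWord [])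
        fun _ => ofWord [] := by
  induction j with
  | zero =>
    rw [OracleTM.cfgAt_zero]
    simp only [OracleTM.init, betCfg]
    congr 1
    funext i
    cases i with
    | work i =>
      simp only [onTapes]
      cases W.tapeEquiv.symm i <;> rfl
    | _ => rfl
  | succ j ih =>
    rw [OracleTM.cfgAt_succ, ih (by omega)]
    have hj' : j < w.length := by omega
    rw [betMachine_step W X Z (f := _) rfl (by
      simp only [onTapes_input, onTapes_numerator, onTapes_denominator, onTapes_some, read_wordAt,
        List.getElem?_eq_getElem hj', Option.isSome_some, if_true]
      rfl)]
    have h1 : (wordAt w j).write (some w[j]) = wordAt w j := by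
      rw [← List.getElem?_eq_getElem hj', ← read_wordAt, write_read]
    have h2 := write_wordAt (w.take j) w[j]
    rw [List.length_take, min_eq_left hj'.le, ← List.take_succ_eq_append_getElem hj'] at h2
    simp only [h1, h2, write_read, move_stay, move_right_wordAt]
    push_cast
    rfl

theorem betMachine_rewind (W : Clockwork) (X Z : BinSeq) (w : List Bool) {j : ℕ}
    (hj : j ≤ w.length) : W.betMachine.cfgAt X Z w (w.length + 1 + j) =
      W.betCfg .rewind (wordAt w (w.length - 1 - j)) (wordAt w (w.length - 1 - j)) (ofWord [])
        (ofWord []) fun _ => ofWord [] := by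
  induction j with
  | zero =>
    rw [Nat.add_zero, OracleTM.cfgAt_succ, betMachine_copy W X Z w le_rfl]
    rw [betMachine_step W X Z (f := _) rfl (by
      simp only [onTapes_input, onTapes_numerator, onTapes_denominator, onTapes_some, read_wordAt,
        List.getElem?_eq_none le_rfl, Option.isSome_none, Bool.false_eq_true, if_false]
      rfl)]
    have h1 : (wordAt w w.length).write none = wordAt w w.length := by
      rw [← List.getElem?_eq_none (le_refl w.length), ← read_wordAt, write_read]
    simp only [List.take_length, h1, write_read, move_stay, move_left_wordAt, Nat.cast_zero,
      sub_zero]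
  | succ j ih =>
    rw [← Nat.add_assoc, OracleTM.cfgAt_succ, ih (by omega)]
    obtain ⟨m, hm⟩ : ∃ m : ℕ, (w.length : ℤ) - 1 - j = m := ⟨w.length - 1 - j, by omega⟩
    have hm' : m < w.length := by omega
    rw [hm]
    rw [betMachine_step W X Z (f := _) rfl (by
      simp only [onTapes_input, onTapes_numerator, onTapes_denominator, onTapes_some, read_wordAt,
        List.getElem?_eq_getElem hm', Option.isSome_some, if_true]
      rfl)]
    have h1 : (wordAt w m).write (some w[m]) = wordAt w m := by
      rw [← List.getElem?_eq_getElem hm', ← read_wordAt, write_read]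
    simp only [h1, write_read, move_stay, move_left_wordAt]
    have : (w.length : ℤ) - 1 - (j + 1 : ℕ) = m - 1 := by push_cast; omega
    rw [this]

/-- Each step of the main phase performs one step of the clockwork. Two heads are needed on the bits
of `X`, at the clockwork's position and at the current one, which is what the copy is for. The
numerator tape collects a digit `0` for each check. -/
theorem betMachine_main (W : Clockwork) (X Z : BinSeq) (N : ℕ) {n : ℕ} (hn : n ≤ N) :
    W.betMachine.cfgAt X Z (X.take N) (2 * N + 2 + n) =
      W.betCfg (.main (W.cfgAt n).state (W.alive X n)) (wordAt (X.take N) (W.cfgAt n).pos)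
        (wordAt (X.take N) n) (wordAt (List.replicate (W.count n) false) (W.count n))
        (ofWord []) (W.cfgAt n).tape := by
  have hlen : (X.take N).length = N := by simp [BinSeq.take]
  induction n with
  | zero =>
    have h := betMachine_rewind W X Z (X.take N) le_rfl
    rw [hlen] at h
    -- Copying and rewinding take `N + 1` steps each, including the step that finds the blank.
    rw [show 2 * N + 2 + 0 = N + 1 + N + 1 by ring, OracleTM.cfgAt_succ, h]
    have hneg : (N : ℤ) - 1 - N = -1 := by ring
    rw [hneg]
    have hread : (wordAt (X.take N) (-1)).read = none := read_wordAt_of_neg _ (by norm_num)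
    rw [betMachine_step W X Z (f := _) rfl (by
      simp only [onTapes_input, onTapes_numerator, onTapes_denominator, onTapes_some, hread,
        Option.isSome_none, Bool.false_eq_true, if_false]
      rfl)]
    have h1 : (wordAt (X.take N) (-1)).write none = wordAt (X.take N) (-1) := by
      rw [← hread, write_read]
    simp only [h1, write_read, move_stay, move_right_wordAt]
    rfl
  | succ n ih =>
    have hn' : n < (X.take N).length := by omega
    have hp : (W.cfgAt n).pos < (X.take N).length := (W.pos_cfgAt_le n).trans_lt hn'
    have hget : ∀ i (hi : i < (X.take N).length), (X.take N)[i] = X i := by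
      intro i hi; simp [BinSeq.take]
    rw [← Nat.add_assoc, OracleTM.cfgAt_succ, ih (by omega)]
    rw [betMachine_step W X Z (f := _) rfl (by
      simp only [onTapes_input, onTapes_numerator, onTapes_denominator, onTapes_some,
        onTapes_none, read_wordAt, List.getElem?_eq_getElem hn', List.getElem?_eq_getElem hp]
      rfl)]
    have h1 : ∀ i (hi : i < (X.take N).length),
        (wordAt (X.take N) i).write (some (X i)) = wordAt (X.take N) i := by
      intro i hi
      rw [← hget i hi, ← List.getElem?_eq_getElem hi, ← read_wordAt, write_read]
    have h2 := write_wordAt (List.replicate (W.count n) false) false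
    rw [List.length_replicate, ← List.replicate_succ'] at h2
    have h3 : (wordAt (List.replicate (W.count n) false) (W.count n)).write none =
        wordAt (List.replicate (W.count n) false) (W.count n) := by
      have := write_read (wordAt (List.replicate (W.count n) false) (W.count n))
      rwa [read_wordAt, List.getElem?_eq_none (by simp)] at this
    simp only [hget, h1 _ hn', h1 _ hp, write_read, move_right_wordAt, move_stay]
    rw [W.cfgAt_succ, alive, count, checks]
    congr 1
    · simp only [step]
      cases W.advance (W.cfgAt n).state <;> simp
    · cases W.check (W.cfgAt n).state
      · simp [h3]
      · simp [h2]

/-- The least significant digit comes first, so a final digit `1` behind the zeros makes the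
numerator `2 ^ count`; for a ruined gambler it is omitted and the numerator is `0`. -/
theorem betMachine_outputs (W : Clockwork) (X Z : BinSeq) (N : ℕ) :
    W.betMachine.OutputsRatWithin X Z (X.take N) (3 * N + 3) (W.capital X N) := by
  have hlen : (X.take N).length = N := by simp [BinSeq.take]
  have hread : (wordAt (X.take N) N).read = none := by
    rw [read_wordAt, List.getElem?_eq_none hlen.le]
  have h3 : (wordAt (List.replicate (W.count N) false) (W.count N)).write none =
      wordAt (List.replicate (W.count N) false) (W.count N) := by
    have := write_read (wordAt (List.replicate (W.count N) false) (W.count N))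
    rwa [read_wordAt, List.getElem?_eq_none (by simp)] at this
  have h := betMachine_main W X Z N le_rfl
  have hfin : W.betMachine.cfgAt X Z (X.take N) (3 * N + 3) =
      W.betCfg .halt (wordAt (X.take N) (W.cfgAt N).pos) (wordAt (X.take N) N)
        (if W.alive X N then wordAt (List.replicate (W.count N) false ++ [true]) (W.count N)
          else wordAt (List.replicate (W.count N) false) (W.count N))
        (wordAt [true] 0) (W.cfgAt N).tape := by
    rw [show 3 * N + 3 = 2 * N + 2 + N + 1 by ring, OracleTM.cfgAt_succ, h]
    rw [betMachine_step W X Z (f := _) rfl (by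
      simp only [onTapes_input, onTapes_numerator, onTapes_some,
        onTapes_none, hread]
      rfl)]
    have h1 : (wordAt (X.take N) N).write none = wordAt (X.take N) N := by
      rw [← hread, write_read]
    have h2 := write_wordAt (List.replicate (W.count N) false) true
    rw [List.length_replicate] at h2
    have h4 : (ofWord []).write (some true) = wordAt [true] 0 := write_wordAt [] true
    simp only [h1, write_read, move_stay, h4]
    congr 1
    cases W.alive X N
    · simp [h3]
    · simp [h2]
  refine ⟨?_, ?_⟩
  · rw [OracleTM.HaltsWithin, hfin]
    rfl
  · rw [hfin]
    have hden : (((W.betCfg .halt (wordAt (X.take N) (W.cfgAt N).pos) (wordAt (X.take N) N)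
        (if W.alive X N then wordAt (List.replicate (W.count N) false ++ [true]) (W.count N)
          else wordAt (List.replicate (W.count N) false) (W.count N))
        (wordAt [true] 0) (W.cfgAt N).tape).tape .denominator).number) = 1 := by
      change (wordAt [true] 0).number = 1
      rw [number_wordAt]
      simp
    have hnum : ((((W.betCfg .halt (wordAt (X.take N) (W.cfgAt N).pos) (wordAt (X.take N) N)
        (if W.alive X N then wordAt (List.replicate (W.count N) false ++ [true]) (W.count N)
          else wordAt (List.replicate (W.count N) false) (W.count N))
        (wordAt [true] 0) (W.cfgAt N).tape).tape .numerator).number : ℕ) : ℚ) =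
        W.capital X N := by
      change (((if W.alive X N then wordAt (List.replicate (W.count N) false ++ [true]) (W.count N)
          else wordAt (List.replicate (W.count N) false) (W.count N) : TMTape).number : ℕ) : ℚ) = _
      rw [capital]
      cases W.alive X N
      · simp [number_wordAt, -List.map_replicate, Nat.ofDigits_replicate_false]
      · simp [number_wordAt, -List.map_replicate, Nat.ofDigits_replicate_false,
          Nat.ofDigits_append]
    refine ⟨by rw [hden]; exact one_ne_zero, ?_⟩
    rw [hden, hnum]
    simp

theorem queried_betMachine (W : Clockwork) (X Z : BinSeq) (w : List Bool) :
    W.betMachine.queried X Z w = ∅ := by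
  refine Set.eq_empty_of_forall_notMem ?_
  rintro p ⟨s, g, h, _⟩
  revert h
  generalize (W.betMachine.cfgAt X Z w s).state = q
  intro h
  change BetState W.State at q
  cases q <;> cases h

theorem revealed_betMachine (W : Clockwork) (X Z : BinSeq) (n : ℕ) :
    revealed W.betMachine X Z n = ∅ := by
  induction n with
  | zero => rfl
  | succ n ih =>
    rw [revealed, ih, queried_betMachine]
    simp

/-- The gambler who bets on all checks being passed. -/
theorem isLookaheadMartingale (W : Clockwork)
    (hW : ∀ n, W.checks n = true → (W.cfgAt n).pos < n) {t : ℕ → ℕ} (ht : Superlinear t)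
    (Z : BinSeq) : IsLookaheadMartingale t Z W.betMachine W.capital where
  computes := by
    obtain ⟨N₀, hN₀⟩ := eventually_atTop.1 ((isLittleO_iff.1 ht) one_pos)
    -- From `N₀` on, `n ≤ t n`; below `N₀` the additive constant alone covers `3 * n + 3`.
    refine ⟨3 * N₀ + 3, fun X n => (W.betMachine_outputs X Z n).mono ?_⟩
    rcases le_or_gt N₀ n with h | h
    · have := hN₀ n h
      simp only [Real.norm_natCast, one_mul, Nat.cast_le] at this
      nlinarith
    · nlinarith [Nat.zero_le ((3 * N₀ + 3) * t n)]
  queries := by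
    refine ⟨0, fun X n _ p hp => ?_⟩
    rw [queried_betMachine] at hp
    exact absurd hp (Set.notMem_empty p)
  init X := by simp [capital, alive, count]
  fair X n _ := W.capital_fair hW X n
  frozen X n hn := by
    rw [revealed_betMachine] at hn
    exact absurd hn (Set.notMem_empty n)

/-- A sequence that passes infinitely many checks and fails none is nonrandom. -/
theorem lookaheadNonrandom (W : Clockwork)
    (hW : ∀ n, W.checks n = true → (W.cfgAt n).pos < n) {t : ℕ → ℕ} (ht : Superlinear t)
    (hinf : ∀ m, ∃ n ≥ m, W.checks n = true) {X : BinSeq}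
    (hX : ∀ n, W.checks n = true → X (W.cfgAt n).pos = X n) : LookaheadNonrandom t X := by
  refine ⟨W.betMachine, W.capital, W.isLookaheadMartingale hW ht zeroSeq, ?_⟩
  have halive : ∀ n, W.alive X n = true := by
    intro n
    induction n with
    | zero => rfl
    | succ n ih =>
      rw [alive, ih]
      cases hc : W.checks n
      · rfl
      · simp [hX n hc]
  have hmono : Monotone W.count := monotone_nat_of_le_succ fun n => Nat.le_add_right _ _
  have hcount : Tendsto W.count atTop atTop := by
    refine tendsto_atTop_atTop_of_monotone hmono fun b => ?_
    induction b with
    | zero => exact ⟨0, le_rfl⟩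
    | succ b ih =>
      obtain ⟨m, hm⟩ := ih
      obtain ⟨n, hn, hc⟩ := hinf m
      refine ⟨n + 1, ?_⟩
      rw [count, hc]
      exact Nat.succ_le_succ (hm.trans (hmono hn))
  have hlim : Tendsto (fun n => ((W.capital X n : ℚ) : ℝ)) atTop atTop := by
    have : (fun n => ((W.capital X n : ℚ) : ℝ)) = (fun k : ℕ => (2 : ℝ) ^ k) ∘ W.count := by
      funext n
      simp [capital, halive]
    rw [this]
    exact (tendsto_pow_atTop_atTop_of_one_lt one_lt_two).comp hcount
  refine Tendsto.limsup_eq ?_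
  rw [EReal.tendsto_nhds_top_iff_real]
  intro x
  filter_upwards [hlim.eventually_gt_atTop x] with n hn
  exact_mod_cast hn

end Clockwork

/-! ### Tapes up to translation -/

namespace TMTape

/-- The contents of a tape, relative to the position of the head. -/
def rel (T : TMTape) (z : ℤ) : Option Bool := T.cells (T.head + z)

/-- Write a symbol and move the head. -/
def act (T : TMTape) (x : Option Bool × HeadMove) : TMTape := (T.write x.1).move x.2

theorem read_eq_rel (T : TMTape) : T.read = T.rel 0 := by simp [read, rel]

theorem rel_act_left (T : TMTape) (a : Option Bool) (z : ℤ) :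
    (T.act (a, .left)).rel z = if z = 1 then a else T.rel (z - 1) := by
  simp only [act, rel, move, write]
  split_ifs with h
  · subst h; simp
  · rw [Function.update_of_ne (by omega)]
    congr 1; ring

theorem rel_act_stay (T : TMTape) (a : Option Bool) (z : ℤ) :
    (T.act (a, .stay)).rel z = if z = 0 then a else T.rel z := by
  simp only [act, rel, move, write]
  split_ifs with h
  · subst h; simp
  · rw [Function.update_of_ne (by omega)]

theorem rel_act_right (T : TMTape) (a : Option Bool) (z : ℤ) :
    (T.act (a, .right)).rel z = if z = -1 then a else T.rel (z + 1) := by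
  simp only [act, rel, move, write]
  split_ifs with h
  · subst h; simp
  · rw [Function.update_of_ne (by omega)]
    congr 1; ring

/-- A machine sees its tapes only relative to the heads, so a simulation may start wherever the
previous one left off. -/
theorem rel_act_congr {T T' : TMTape} (h : T.rel = T'.rel) (x : Option Bool × HeadMove) :
    (T.act x).rel = (T'.act x).rel := by
  obtain ⟨a, _ | _ | _⟩ := x <;> funext z
  · rw [rel_act_left, rel_act_left, h]
  · rw [rel_act_stay, rel_act_stay, h]
  · rw [rel_act_right, rel_act_right, h]

/-- Relative to the head, the nonblank cells are between `a` and `b`. -/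
def Band (a b : ℤ) (T : TMTape) : Prop := ∀ z, T.rel z ≠ none → a ≤ z ∧ z ≤ b

theorem Band.mono {a b a' b' : ℤ} {T : TMTape} (h : Band a b T) (ha : a' ≤ a) (hb : b ≤ b') :
    Band a' b' T := fun z hz => ⟨ha.trans (h z hz).1, (h z hz).2.trans hb⟩

theorem Band.act {s : ℤ} {T : TMTape} (h : Band (-s) s T) (hs : 0 ≤ s)
    (x : Option Bool × HeadMove) : Band (-(s + 1)) (s + 1) (T.act x) := by
  intro z hz
  obtain ⟨a, _ | _ | _⟩ := x
  · rw [rel_act_left] at hz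
    split_ifs at hz with h1
    · omega
    · have := h _ hz; omega
  · rw [rel_act_stay] at hz
    split_ifs at hz with h1
    · omega
    · have := h _ hz; omega
  · rw [rel_act_right] at hz
    split_ifs at hz with h1
    · omega
    · have := h _ hz; omega

theorem Band.act_right {a b : ℤ} {T : TMTape} (h : Band a b T) :
    Band (a - 1) (b - 1) (T.act (T.read, .right)) := by
  intro z hz
  rw [rel_act_right, read_eq_rel] at hz
  split_ifs at hz with h1
  · have := h _ hz; omega
  · have := h _ hz; omega

/-- The scanned cell is the rightmost that can be nonblank. It is blanked, and the head moves on to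
its left neighbour. -/
theorem Band.erase {a : ℤ} {T : TMTape} (h : Band a 0 T) :
    Band (a + 1) 0 (T.act (none, .left)) := by
  intro z hz
  rw [rel_act_left] at hz
  split_ifs at hz with h1
  · exact absurd rfl hz
  · have := h _ hz; omega

/-- The empty interval from `1` to `0` expresses that a tape is blank, wherever its head is. -/
theorem band_blank : Band 1 0 (ofWord []) := by
  intro z hz
  simp [rel, ofWord] at hz

/-- The tape with `a` marks, starting in cell `0`, and with its head on cell `h`. -/
def marks (a : ℕ) (h : ℤ) : TMTape := wordAt (List.replicate a true) h

theorem read_marks_of_lt {a h : ℕ} (hh : h < a) : (marks a h).read = some true := by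
  simp [marks, hh]

theorem read_marks_of_le {a h : ℕ} (hh : a ≤ h) : (marks a h).read = none := by
  simp [marks, hh]

theorem read_marks_of_neg {a : ℕ} {h : ℤ} (hh : h < 0) : (marks a h).read = none :=
  read_wordAt_of_neg _ hh

@[simp]
theorem act_read_stay (T : TMTape) : T.act (T.read, .stay) = T := by simp [act]

@[simp]
theorem marks_act_left (a : ℕ) (h : ℤ) :
    (marks a h).act ((marks a h).read, .left) = marks a (h - 1) := by
  rw [act, write_read]; rfl

@[simp]
theorem marks_act_right (a : ℕ) (h : ℤ) :
    (marks a h).act ((marks a h).read, .right) = marks a (h + 1) := by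
  rw [act, write_read]; rfl

theorem marks_write (a : ℕ) : (marks a a).write (some true) = marks (a + 1) a := by
  have := write_wordAt (List.replicate a true) true
  rwa [List.length_replicate, ← List.replicate_succ'] at this

@[simp]
theorem marks_act_push (a : ℕ) : (marks a a).act (some true, .right) = marks (a + 1) (a + 1) := by
  rw [act, marks_write]; rfl

end TMTape

namespace Clockwork

theorem cfgAt_within (W : Clockwork) (n : ℕ) (a : W.Tape) : ((W.cfgAt n).tape a).Within n := by
  induction n with
  | zero => exact TMTape.within_blank
  | succ n ih =>
    rw [cfgAt_succ]
    exact ih.write_move _ _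

/-! ### Performing the checks at odd times only -/

/-- The clockwork that waits, if necessary, so that all checks are demanded at odd times. -/
def oddChecks (W : Clockwork) : Clockwork where
  Tape := W.Tape
  State := W.State × Bool
  finTape := W.finTape
  finState := have := W.finState; inferInstance
  start := (W.start, false)
  next q r :=
    if W.check q.1 && !q.2 then ((q.1, !q.2), fun a => (r a, .stay))
    else (((W.next q.1 r).1, !q.2), (W.next q.1 r).2)
  check q := W.check q.1 && q.2
  advance q := if W.check q.1 && !q.2 then false else W.advance q.1

/-- How many steps of the original clockwork have been performed. -/
def progress (W : Clockwork) : ℕ → ℕ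
  | 0 => 0
  | n + 1 => if W.checks (W.progress n) && !decide (n % 2 = 1) then W.progress n
      else W.progress n + 1

/-- The additional bit of the state is the parity of the time. -/
theorem oddChecks_cfgAt (W : Clockwork) (n : ℕ) : W.oddChecks.cfgAt n =
    ⟨((W.cfgAt (W.progress n)).state, decide (n % 2 = 1)), (W.cfgAt (W.progress n)).tape,
      (W.cfgAt (W.progress n)).pos⟩ := by
  induction n with
  | zero => rfl
  | succ n ih =>
    have hpar : decide ((n + 1) % 2 = 1) = !decide (n % 2 = 1) := by
      rw [← decide_not, decide_eq_decide]; omega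
    rw [cfgAt_succ, ih, progress, hpar]
    by_cases h : (W.checks (W.progress n) && !decide (n % 2 = 1)) = true
    · rw [if_pos h]
      have h' : (W.check (W.cfgAt (W.progress n)).state && !decide (n % 2 = 1)) = true := h
      simp only [step, oddChecks, h', if_true]
      simp
    · rw [if_neg h, cfgAt_succ]
      have h' : ¬ (W.check (W.cfgAt (W.progress n)).state && !decide (n % 2 = 1)) = true := h
      simp only [step, oddChecks, if_neg h']

theorem oddChecks_checks (W : Clockwork) (n : ℕ) :
    W.oddChecks.checks n = (W.checks (W.progress n) && decide (n % 2 = 1)) := by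
  rw [checks, oddChecks_cfgAt]
  rfl

theorem progress_mono (W : Clockwork) : Monotone W.progress := by
  refine monotone_nat_of_le_succ fun n => ?_
  rw [progress]
  split_ifs <;> omega

theorem progress_le (W : Clockwork) (n : ℕ) : W.progress n ≤ n := by
  induction n with
  | zero => exact le_rfl
  | succ n ih =>
    rw [progress]
    split_ifs <;> omega

theorem progress_succ_of_odd (W : Clockwork) {n : ℕ} (hn : n % 2 = 1) :
    W.progress (n + 1) = W.progress n + 1 := by
  rw [progress]
  simp [hn]

/-- Every check of the original clockwork is performed. -/
theorem exists_progress_eq (W : Clockwork) {m : ℕ} (hm : W.checks m = true) :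
    ∃ n, n % 2 = 1 ∧ W.progress n = m := by
  have hex : ∀ m, ∃ n, W.progress n = m := by
    intro m
    induction m with
    | zero => exact ⟨0, rfl⟩
    | succ m ih =>
      obtain ⟨n, hn⟩ := ih
      by_cases h : (W.checks (W.progress n) && !decide (n % 2 = 1)) = true
      -- A check that is due at an even time is put off by one step and carried out at the odd time
      -- that follows.
      · refine ⟨n + 2, ?_⟩
        have h1 : W.progress (n + 1) = m := by rw [progress, if_pos h, hn]
        rw [W.progress_succ_of_odd, h1]
        simp at h
        omega
      · exact ⟨n + 1, by rw [progress, if_neg h, hn]⟩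
  obtain ⟨n, hn⟩ := hex m
  by_cases h : n % 2 = 1
  · exact ⟨n, h, hn⟩
  · refine ⟨n + 1, by omega, ?_⟩
    rw [progress, hn, hm]
    simp [h]

/-- If the clockwork checks exactly at the times `e k`, with the position `2 * k`, then there are
odd times `2 * g k + 1 ≥ e k` at which the modified clockwork checks. -/
theorem exists_oddChecks (W : Clockwork) {e : ℕ → ℕ} (he : StrictMono e)
    (hpos : ∀ k, (W.cfgAt (e k)).pos = 2 * k)
    (hcheck : ∀ n, W.checks n = true ↔ ∃ k, e k = n) :
    ∃ g : ℕ → ℕ, StrictMono g ∧ (∀ k, e k ≤ 2 * g k + 1) ∧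
      (∀ k, (W.oddChecks.cfgAt (2 * g k + 1)).pos = 2 * k) ∧
      ∀ n, W.oddChecks.checks n = true ↔ ∃ k, 2 * g k + 1 = n := by
  choose f hodd hf using fun k => W.exists_progress_eq ((hcheck (e k)).2 ⟨k, rfl⟩)
  have hfg : ∀ k, 2 * (f k / 2) + 1 = f k := fun k => by have := hodd k; omega
  -- An odd step always makes progress, so a given amount of progress is present at one odd time at
  -- most; no check is performed twice.
  have hinj : ∀ m n, m % 2 = 1 → n % 2 = 1 → W.progress m = W.progress n → m = n := by
    have aux : ∀ m n, m < n → m % 2 = 1 → W.progress m ≠ W.progress n := by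
      intro m n hmn hm h
      have h1 := W.progress_mono (Nat.succ_le_of_lt hmn)
      rw [Nat.succ_eq_add_one, W.progress_succ_of_odd hm] at h1
      omega
    intro m n hm hn h
    rcases lt_trichotomy m n with h1 | h1 | h1
    · exact absurd h (aux m n h1 hm)
    · exact h1
    · exact absurd h.symm (aux n m h1 hn)
  refine ⟨fun k => f k / 2, fun k l hkl => ?_, fun k => ?_, fun k => ?_, fun n => ?_⟩
  · have h1 : f k < f l := by
      by_contra hc
      have := W.progress_mono (not_lt.1 hc)
      rw [hf, hf] at this
      exact absurd (he hkl) (not_lt.2 this)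
    have := hfg k
    have := hfg l
    change f k / 2 < f l / 2
    omega
  · rw [hfg, ← hf k]
    exact W.progress_le _
  · rw [hfg, oddChecks_cfgAt, hf]
    exact hpos k
  · rw [oddChecks_checks, Bool.and_eq_true, decide_eq_true_eq, hcheck]
    simp only [hfg]
    constructor
    · rintro ⟨⟨k, hk⟩, hn⟩
      exact ⟨k, hinj _ _ (hodd k) hn (by rw [hf, hk])⟩
    · rintro ⟨k, rfl⟩
      exact ⟨⟨k, (hf k).symm⟩, hodd k⟩

/-! ### Runs between two checks -/

/-- One step from a configuration in which no check is demanded. -/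
def SilentStep (W : Clockwork) (c c' : W.Cfg) : Prop := W.check c.state = false ∧ c' = W.step c

/-- Finitely many steps without checks. -/
abbrev Silent (W : Clockwork) : W.Cfg → W.Cfg → Prop := Relation.ReflTransGen W.SilentStep

theorem Silent.exists_iterate {W : Clockwork} {c c' : W.Cfg} (h : W.Silent c c') :
    ∃ n, W.step^[n] c = c' ∧ ∀ i < n, W.check (W.step^[i] c).state = false := by
  induction h with
  | refl => exact ⟨0, rfl, fun i hi => absurd hi (Nat.not_lt_zero i)⟩
  | tail _ h ih =>
    obtain ⟨n, rfl, hn⟩ := ih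
    refine ⟨n + 1, by rw [Function.iterate_succ_apply', h.2], fun i hi => ?_⟩
    rcases Nat.lt_succ_iff_lt_or_eq.1 hi with hi | rfl
    · exact hn i hi
    · exact h.1

/-- If the run consists of stages with one check each, then the checks can be enumerated. -/
theorem exists_check_times (W : Clockwork) (Stage : ℕ → W.Cfg → Prop)
    (hcheck : ∀ k c, Stage k c → W.check c.state = true)
    (hstart : ∃ c, W.Silent W.init c ∧ Stage 0 c)
    (hnext : ∀ k c, Stage k c → ∃ c', W.Silent (W.step c) c' ∧ Stage (k + 1) c') :
    ∃ e : ℕ → ℕ, StrictMono e ∧ (∀ k, Stage k (W.cfgAt (e k))) ∧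
      ∀ n, W.checks n = true ↔ ∃ k, e k = n := by
  obtain ⟨c₀, h0, hc₀⟩ := hstart
  obtain ⟨n₀, rfl, hn₀⟩ := h0.exists_iterate
  have hstep : ∀ k n, Stage k (W.cfgAt n) → ∃ n', n < n' ∧ Stage (k + 1) (W.cfgAt n') ∧
      ∀ i, n < i → i < n' → W.checks i = false := by
    intro k n hn
    obtain ⟨c', hs, hc'⟩ := hnext k _ hn
    obtain ⟨m, rfl, hm⟩ := hs.exists_iterate
    have hit : ∀ i, W.step^[i] (W.step (W.cfgAt n)) = W.cfgAt (n + 1 + i) := by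
      intro i
      rw [← cfgAt_succ, cfgAt, cfgAt, ← Function.iterate_add_apply, Nat.add_comm]
    refine ⟨n + 1 + m, by omega, by rwa [hit] at hc', fun i hi hi' => ?_⟩
    obtain ⟨j, rfl⟩ := Nat.exists_eq_add_of_lt hi
    have := hm j (by omega)
    rw [hit] at this
    rw [checks, show n + j + 1 = n + 1 + j by ring]
    exact this
  choose! nxt hlt hstage hsil using hstep
  let e : ℕ → ℕ := fun k => Nat.rec n₀ (fun k n => nxt k n) k
  have hes : ∀ k, Stage k (W.cfgAt (e k)) := by
    intro k
    induction k with
    | zero => exact hc₀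
    | succ k ih => exact hstage k _ ih
  have hmono : StrictMono e := strictMono_nat_of_lt_succ fun k => hlt k _ (hes k)
  refine ⟨e, hmono, hes, fun n => ⟨fun hn => ?_, ?_⟩⟩
  -- Before the first check time and between consecutive ones the run is silent, so a further check
  -- would come after all `e k`, which are unbounded.
  · by_contra hne
    rw [not_exists] at hne
    have h1 : ∀ k, e k < n := by
      intro k
      induction k with
      | zero =>
        refine lt_of_le_of_ne ?_ (hne 0)
        by_contra hc
        have := hn₀ n (not_le.1 hc)
        rw [checks, cfgAt, this] at hn
        cases hn
      | succ k ih =>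
        refine lt_of_le_of_ne ?_ (hne (k + 1))
        by_contra hc
        have := hsil k _ (hes k) n ih (not_le.1 hc)
        rw [this] at hn
        cases hn
    have := hmono.id_le n
    have := h1 n
    simp only [id] at *
    omega
  · rintro ⟨k, rfl⟩
    exact hcheck k _ (hes k)

end Clockwork

/-! ### A clockwork that is slower than a given machine

In each stage the given machine is run on an input `1 ^ j`, and each of its steps is recorded by a
mark on the clock tape. The clock is then used to erase the tapes of the machine, and to grow
the number of marks on the tape `front` to at least an exponential of the number of marks on
the clock. These marks are added to the clock before the next check, and the next stage follows. -/

namespace OracleTM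

open TMTape Clockwork

/-- Tapes of the clockwork besides those of the machine. -/
inductive ClockTape : Type
  | clock
  | front
  | back
  | input

instance : Finite ClockTape :=
  Finite.of_injective (β := Fin 4) (fun | .clock => 0 | .front => 1 | .back => 2 | .input => 3)
    (by intro a b; cases a <;> cases b <;> simp)

/-- States of the clockwork. -/
inductive ClockState (Q : Type) : Type
  | init₁
  | init₂
  | copy
  | run (q : Q)
  | sweep₁
  | sweep₂
  | sweep₃
  | loop
  | frontLeft
  | frontRight
  | backLeft
  | backRight
  | addLeft
  | addRight
  | extend
  | check
  | recover

instance (Q : Type) [Finite Q] : Finite (ClockState Q) :=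
  Finite.of_surjective (α := Q ⊕ Fin 16)
    (fun
      | .inl q => .run q
      | .inr i => ![.init₁, .init₂, .copy, .sweep₁, .sweep₂, .sweep₃, .loop, .frontLeft,
          .frontRight, .backLeft, .backRight, .addLeft, .addRight, .extend, .check, .recover] i)
    (by
      intro s
      cases s with
      | run q => exact ⟨.inl q, rfl⟩
      | init₁ => exact ⟨.inr 0, rfl⟩
      | init₂ => exact ⟨.inr 1, rfl⟩
      | copy => exact ⟨.inr 2, rfl⟩
      | sweep₁ => exact ⟨.inr 3, rfl⟩
      | sweep₂ => exact ⟨.inr 4, rfl⟩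
      | sweep₃ => exact ⟨.inr 5, rfl⟩
      | loop => exact ⟨.inr 6, rfl⟩
      | frontLeft => exact ⟨.inr 7, rfl⟩
      | frontRight => exact ⟨.inr 8, rfl⟩
      | backLeft => exact ⟨.inr 9, rfl⟩
      | backRight => exact ⟨.inr 10, rfl⟩
      | addLeft => exact ⟨.inr 11, rfl⟩
      | addRight => exact ⟨.inr 12, rfl⟩
      | extend => exact ⟨.inr 13, rfl⟩
      | check => exact ⟨.inr 14, rfl⟩
      | recover => exact ⟨.inr 15, rfl⟩)

/-- What the clockwork does in one step. -/
structure ClockAction (M : OracleTM) : Type where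
  state : ClockState M.Q
  main : TapeName M.k → Option Bool × HeadMove
  clock : Option Bool × HeadMove
  front : Option Bool × HeadMove
  back : Option Bool × HeadMove
  input : Option Bool × HeadMove

/-- The action of the clockwork, depending on the scanned symbols. -/
def clockAction (M : OracleTM) (q : ClockState M.Q) (m : TapeName M.k → Option Bool)
    (c f b u : Option Bool) : ClockAction M :=
  let keep := fun i => (m i, HeadMove.stay)
  let erase : TapeName M.k → Option Bool × HeadMove := fun _ => (none, .left)
  let push : Option Bool × HeadMove := (some true, .right)
  match q with
  | .init₁ => ⟨.init₂, keep, (c, .stay), (f, .stay), (b, .stay), push⟩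
  | .init₂ => ⟨.extend, keep, (c, .stay), (f, .stay), (b, .stay), push⟩
  | .copy =>
    if u.isSome then
      ⟨.copy, fun | .input => (some true, .left) | i => keep i, push, (f, .stay), (b, .stay),
        (u, .left)⟩
    else
      ⟨.run M.start, fun | .input => (m .input, .right) | i => keep i, (c, .stay), (f, .stay),
        (b, .stay), (u, .right)⟩
  | .run s =>
    match M.instr s with
    | .halt => ⟨.sweep₁, keep, (c, .left), (f, .stay), (b, .stay), (u, .stay)⟩
    | .act g => ⟨.run (g m).1, (g m).2, push, (f, .stay), (b, .stay), (u, .stay)⟩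
    | .ask _ g => ⟨.run (g false), keep, push, (f, .stay), (b, .stay), (u, .stay)⟩
  | .sweep₁ =>
    if c.isSome then
      ⟨.sweep₁, fun i => (m i, .right), (c, .left), (f, .stay), (b, .stay), (u, .stay)⟩
    else ⟨.sweep₂, keep, (c, .right), (f, .stay), (b, .stay), (u, .stay)⟩
  | .sweep₂ =>
    if c.isSome then ⟨.sweep₂, erase, (c, .right), (f, .stay), (b, .stay), (u, .stay)⟩
    else ⟨.sweep₃, erase, (c, .left), (f, .stay), (b, .stay), (u, .stay)⟩
  | .sweep₃ =>
    if c.isSome then ⟨.sweep₃, erase, (c, .left), (f, .stay), (b, .stay), (u, .stay)⟩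
    else ⟨.loop, keep, (c, .right), (f, .stay), (b, .stay), (u, .stay)⟩
  | .loop =>
    if c.isSome then ⟨.frontLeft, keep, (c, .right), (f, .left), (b, .stay), (u, .stay)⟩
    else ⟨.addLeft, keep, (c, .stay), (f, .left), (b, .stay), (u, .stay)⟩
  | .frontLeft =>
    if f.isSome then ⟨.frontLeft, keep, (c, .stay), (f, .left), push, (u, .stay)⟩
    else ⟨.frontRight, keep, (c, .stay), (f, .right), push, (u, .stay)⟩
  | .frontRight =>
    if f.isSome then ⟨.frontRight, keep, (c, .stay), (f, .right), push, (u, .stay)⟩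
    else ⟨.backLeft, keep, (c, .stay), (f, .stay), (b, .left), (u, .stay)⟩
  | .backLeft =>
    if b.isSome then ⟨.backLeft, keep, (c, .stay), push, (b, .left), (u, .stay)⟩
    else ⟨.backRight, keep, (c, .stay), push, (b, .right), (u, .stay)⟩
  | .backRight =>
    if b.isSome then ⟨.backRight, keep, (c, .stay), push, (b, .right), (u, .stay)⟩
    else ⟨.loop, keep, (c, .stay), (f, .stay), (b, .stay), (u, .stay)⟩
  | .addLeft =>
    if f.isSome then ⟨.addLeft, keep, push, (f, .left), (b, .stay), (u, .stay)⟩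
    else ⟨.addRight, keep, (c, .stay), (f, .right), (b, .stay), (u, .stay)⟩
  | .addRight =>
    if f.isSome then ⟨.addRight, keep, (c, .stay), (f, .right), (b, .stay), (u, .stay)⟩
    else ⟨.extend, keep, (c, .stay), (f, .stay), (b, .stay), (u, .stay)⟩
  | .extend =>
    if u.isSome then ⟨.extend, keep, (c, .stay), (f, .stay), (b, .stay), (u, .right)⟩
    else ⟨.check, keep, (c, .stay), (f, .stay), (b, .stay), (some true, .stay)⟩
  | .check => ⟨.recover, keep, (c, .stay), (f, .stay), (b, .stay), (u, .stay)⟩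
  | .recover => ⟨.copy, keep, (c, .stay), (f, .stay), (b, .stay), (u, .stay)⟩

/-- The clockwork. It demands a check in each stage; each check advances the position by two. -/
def clockwork (M : OracleTM) : Clockwork where
  Tape := TapeName M.k ⊕ ClockTape
  State := ClockState M.Q
  finTape := inferInstance
  finState := have := M.finQ; inferInstance
  start := .init₁
  next q r :=
    let a := M.clockAction q (fun i => r (.inl i)) (r (.inr .clock)) (r (.inr .front))
      (r (.inr .back)) (r (.inr .input))
    (a.state, fun
      | .inl i => a.main i
      | .inr .clock => a.clock
      | .inr .front => a.front
      | .inr .back => a.back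
      | .inr .input => a.input)
  check
    | .check => true
    | _ => false
  advance
    | .check => true
    | .recover => true
    | _ => false

/-- A configuration of the clockwork. -/
def clockCfg (M : OracleTM) (q : ClockState M.Q) (m : TapeName M.k → TMTape)
    (c f b u : TMTape) (pos : ℕ) : M.clockwork.Cfg where
  state := q
  tape
    | .inl i => m i
    | .inr .clock => c
    | .inr .front => f
    | .inr .back => b
    | .inr .input => u
  pos := pos

theorem clockwork_step (M : OracleTM) (q : ClockState M.Q) (m : TapeName M.k → TMTape)
    (c f b u : TMTape) (pos : ℕ) :
    M.clockwork.step (M.clockCfg q m c f b u pos) =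
      let a := M.clockAction q (fun i => (m i).read) c.read f.read b.read u.read
      M.clockCfg a.state (fun i => (m i).act (a.main i)) (c.act a.clock) (f.act a.front)
        (b.act a.back) (u.act a.input) (pos + (M.clockwork.advance q).toNat) := by
  simp only [Clockwork.step, clockCfg]
  refine congrArg₂ (fun s t => Clockwork.Cfg.mk (W := M.clockwork) s t _) rfl ?_
  funext i
  rcases i with i | _ | _ | _ | _ <;> rfl

variable {M : OracleTM} {m : TapeName M.k → TMTape} {c f b u : TMTape} {pos : ℕ}

theorem silentStep_clockCfg {q q' : ClockState M.Q} {m' : TapeName M.k → TMTape}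
    {c' f' b' u' : TMTape} (hq : M.clockwork.check q = false)
    (hq' : M.clockwork.advance q = false)
    (h : (let a := M.clockAction q (fun i => (m i).read) c.read f.read b.read u.read
      M.clockCfg a.state (fun i => (m i).act (a.main i)) (c.act a.clock) (f.act a.front)
        (b.act a.back) (u.act a.input) pos) = M.clockCfg q' m' c' f' b' u' pos) :
    M.clockwork.SilentStep (M.clockCfg q m c f b u pos) (M.clockCfg q' m' c' f' b' u' pos) := by
  refine ⟨hq, ?_⟩
  rw [clockwork_step, hq', ← h]
  rfl

/-! #### Growing the clock -/

theorem isSome_marks_of_lt {a h : ℕ} (hh : h < a) : (marks a h).read.isSome = true := by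
  rw [read_marks_of_lt hh]; rfl

theorem isSome_marks_of_le {a h : ℕ} (hh : a ≤ h) : (marks a h).read.isSome = false := by
  rw [read_marks_of_le hh]; rfl

theorem isSome_marks_neg (a : ℕ) : (marks a (-1)).read.isSome = false := by
  rw [read_marks_of_neg (by norm_num)]; rfl

theorem cast_succ_sub_one (i : ℕ) : ((i + 1 : ℕ) : ℤ) - 1 = i := by push_cast; ring

/-- The turn at the blank also pushes a mark; hence `i + 1` new marks for `i` old ones. -/
theorem silent_frontLeft {p q i : ℕ} (hi : i ≤ p) :
    M.clockwork.Silent (M.clockCfg .frontLeft m c (marks p (i - 1)) (marks q q) u pos)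
      (M.clockCfg .frontRight m c (marks p 0) (marks (q + i + 1) (q + i + 1 : ℕ)) u pos) := by
  induction i generalizing q with
  | zero =>
    refine .single (silentStep_clockCfg rfl rfl ?_)
    simp [clockAction, isSome_marks_neg, -Option.isSome_eq_false_iff]
  | succ i ih =>
    have h := isSome_marks_of_lt (a := p) (h := i) (by omega)
    refine .head (silentStep_clockCfg (f' := marks p (i - 1)) (b' := marks (q + 1) (q + 1 : ℕ))
      rfl rfl ?_) (ih (q := q + 1) (by omega) |>.trans (by
        rw [show q + 1 + i + 1 = q + (i + 1) + 1 by ring]))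
    rw [cast_succ_sub_one]
    simp [clockAction, h]

theorem silent_frontRight {p q i : ℕ} (hi : i ≤ p) :
    M.clockwork.Silent (M.clockCfg .frontRight m c (marks p (p - i : ℕ)) (marks q q) u pos)
      (M.clockCfg .backLeft m c (marks p p) (marks (q + i) ((q + i : ℕ) - 1)) u pos) := by
  induction i generalizing q with
  | zero =>
    refine .single (silentStep_clockCfg rfl rfl ?_)
    have h := isSome_marks_of_le (a := p) (h := p) le_rfl
    simp [clockAction, h, -Option.isSome_eq_false_iff]
  | succ i ih =>
    have h := isSome_marks_of_lt (a := p) (h := p - (i + 1)) (by omega)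
    refine .head (silentStep_clockCfg (f' := marks p (p - i : ℕ))
      (b' := marks (q + 1) (q + 1 : ℕ)) rfl rfl ?_) (ih (q := q + 1) (by omega) |>.trans (by
        rw [show q + 1 + i = q + (i + 1) by ring]))
    have h2 : ((p - i : ℕ) : ℤ) = (p - (i + 1) : ℕ) + 1 := by omega
    rw [h2]
    simp [clockAction, h]

theorem silent_backLeft {p q i : ℕ} (hi : i ≤ q) :
    M.clockwork.Silent (M.clockCfg .backLeft m c (marks p p) (marks q (i - 1)) u pos)
      (M.clockCfg .backRight m c (marks (p + i + 1) (p + i + 1 : ℕ)) (marks q 0) u pos) := by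
  induction i generalizing p with
  | zero =>
    refine .single (silentStep_clockCfg rfl rfl ?_)
    simp [clockAction, isSome_marks_neg, -Option.isSome_eq_false_iff]
  | succ i ih =>
    have h := isSome_marks_of_lt (a := q) (h := i) (by omega)
    refine .head (silentStep_clockCfg (b' := marks q (i - 1)) (f' := marks (p + 1) (p + 1 : ℕ))
      rfl rfl ?_) (ih (p := p + 1) (by omega) |>.trans (by
        rw [show p + 1 + i + 1 = p + (i + 1) + 1 by ring]))
    rw [cast_succ_sub_one]
    simp [clockAction, h]

theorem silent_backRight {p q i : ℕ} (hi : i ≤ q) :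
    M.clockwork.Silent (M.clockCfg .backRight m c (marks p p) (marks q (q - i : ℕ)) u pos)
      (M.clockCfg .loop m c (marks (p + i) (p + i : ℕ)) (marks q q) u pos) := by
  induction i generalizing p with
  | zero =>
    refine .single (silentStep_clockCfg rfl rfl ?_)
    have h := isSome_marks_of_le (a := q) (h := q) le_rfl
    simp [clockAction, h, -Option.isSome_eq_false_iff]
  | succ i ih =>
    have h := isSome_marks_of_lt (a := q) (h := q - (i + 1)) (by omega)
    refine .head (silentStep_clockCfg (b' := marks q (q - i : ℕ))
      (f' := marks (p + 1) (p + 1 : ℕ)) rfl rfl ?_) (ih (p := p + 1) (by omega) |>.trans (by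
        rw [show p + 1 + i = p + (i + 1) by ring]))
    have h2 : ((q - i : ℕ) : ℤ) = (q - (i + 1) : ℕ) + 1 := by omega
    rw [h2]
    simp [clockAction, h]

/-- Traversing one tape lengthens the other one, since a head that traverses a tape cannot append to
it. Going both ways along `front` adds `2 * p + 1` marks to `back`; going both ways along `back`
then adds `2 * q' + 1` marks to `front`, which is more than enough to double `p + 1`. -/
theorem silent_round {s h p q : ℕ} (hh : h < s) : ∃ p' q' : ℕ, 2 * (p + 1) ≤ p' + 1 ∧
    M.clockwork.Silent (M.clockCfg .loop m (marks s h) (marks p p) (marks q q) u pos)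
      (M.clockCfg .loop m (marks s (h + 1 : ℕ)) (marks p' p') (marks q' q') u pos) := by
  set q' := q + p + 1 + p with hq'
  refine ⟨p + q' + 1 + q', q', by omega, ?_⟩
  have h0 := isSome_marks_of_lt hh
  refine .head (silentStep_clockCfg (c' := marks s (h + 1 : ℕ)) (f' := marks p (p - 1))
    (q' := .frontLeft) (m' := m) (b' := marks q q) (u' := u) rfl rfl
    (by simp [clockAction, h0])) ?_
  refine (silent_frontLeft (i := p) le_rfl).trans ?_
  have h1 := silent_frontRight (M := M) (m := m) (c := marks s (h + 1 : ℕ)) (u := u) (pos := pos)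
    (q := q + p + 1) (le_refl p)
  rw [Nat.sub_self] at h1
  refine h1.trans ?_
  refine (silent_backLeft (i := q') le_rfl).trans ?_
  have h2 := silent_backRight (M := M) (m := m) (c := marks s (h + 1 : ℕ)) (u := u) (pos := pos)
    (p := p + q' + 1) (le_refl q')
  rwa [Nat.sub_self] at h2

/-- Every clock mark causes one round, and every round at least doubles the number of marks on
`front` plus one. -/
theorem silent_loop {s n p q : ℕ} (hn : n ≤ s) : ∃ p' q' : ℕ, 2 ^ n * (p + 1) ≤ p' + 1 ∧
    M.clockwork.Silent (M.clockCfg .loop m (marks s (s - n : ℕ)) (marks p p) (marks q q) u pos)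
      (M.clockCfg .addLeft m (marks s s) (marks p' (p' - 1)) (marks q' q') u pos) := by
  induction n generalizing p q with
  | zero =>
    refine ⟨p, q, by simp, .single (silentStep_clockCfg rfl rfl ?_)⟩
    have h := isSome_marks_of_le (a := s) (h := s) le_rfl
    simp [clockAction, h, -Option.isSome_eq_false_iff]
  | succ n ih =>
    obtain ⟨p₁, q₁, hp₁, h1⟩ := silent_round (M := M) (m := m) (u := u) (pos := pos) (p := p)
      (q := q) (show s - (n + 1) < s by omega)
    rw [show s - (n + 1) + 1 = s - n by omega] at h1
    obtain ⟨p₂, q₂, hp₂, h2⟩ := ih (p := p₁) (q := q₁) (by omega)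
    refine ⟨p₂, q₂, le_trans ?_ hp₂, h1.trans h2⟩
    rw [pow_succ, mul_assoc]
    gcongr

theorem silent_addLeft {s p i : ℕ} (hi : i ≤ p) :
    M.clockwork.Silent (M.clockCfg .addLeft m (marks s s) (marks p (i - 1)) b u pos)
      (M.clockCfg .addRight m (marks (s + i) (s + i : ℕ)) (marks p 0) b u pos) := by
  induction i generalizing s with
  | zero =>
    refine .single (silentStep_clockCfg rfl rfl ?_)
    simp [clockAction, isSome_marks_neg, -Option.isSome_eq_false_iff]
  | succ i ih =>
    have h := isSome_marks_of_lt (a := p) (h := i) (by omega)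
    refine .head (silentStep_clockCfg (f' := marks p (i - 1)) (c' := marks (s + 1) (s + 1 : ℕ))
      rfl rfl ?_) (ih (s := s + 1) (by omega) |>.trans (by
        rw [show s + 1 + i = s + (i + 1) by ring]))
    rw [cast_succ_sub_one]
    simp [clockAction, h]

theorem silent_addRight {p i : ℕ} (hi : i ≤ p) :
    M.clockwork.Silent (M.clockCfg .addRight m c (marks p (p - i : ℕ)) b u pos)
      (M.clockCfg .extend m c (marks p p) b u pos) := by
  induction i with
  | zero =>
    refine .single (silentStep_clockCfg rfl rfl ?_)
    have h := isSome_marks_of_le (a := p) (h := p) le_rfl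
    simp [clockAction, h, -Option.isSome_eq_false_iff]
  | succ i ih =>
    have h := isSome_marks_of_lt (a := p) (h := p - (i + 1)) (by omega)
    refine .head (silentStep_clockCfg (f' := marks p (p - i : ℕ)) rfl rfl ?_) (ih (by omega))
    have h2 : ((p - i : ℕ) : ℤ) = (p - (i + 1) : ℕ) + 1 := by omega
    rw [h2]
    simp [clockAction, h]

/-- The new mark is written without a move, so the head ends on the last mark, where the next
copying has to begin. -/
theorem silent_extend {j i : ℕ} (hi : i ≤ j) :
    M.clockwork.Silent (M.clockCfg .extend m c f b (marks j (j - i : ℕ)) pos)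
      (M.clockCfg .check m c f b (marks (j + 1) j) pos) := by
  induction i with
  | zero =>
    refine .single (silentStep_clockCfg rfl rfl ?_)
    have h := isSome_marks_of_le (a := j) (h := j) le_rfl
    simp [clockAction, h, act, marks_write, -Option.isSome_eq_false_iff]
  | succ i ih =>
    have h := isSome_marks_of_lt (a := j) (h := j - (i + 1)) (by omega)
    refine .head (silentStep_clockCfg (u' := marks j (j - i : ℕ)) rfl rfl ?_) (ih (by omega))
    have h2 : ((j - i : ℕ) : ℤ) = (j - (i + 1) : ℕ) + 1 := by omega
    rw [h2]
    simp [clockAction, h]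

/-- The second half of a stage: the clock grows exponentially. -/
theorem silent_grow {s p q j : ℕ} : ∃ s' p' q' : ℕ, s + 2 ^ s ≤ s' + 1 ∧
    M.clockwork.Silent (M.clockCfg .loop m (marks s 0) (marks p p) (marks q q) (marks j 0) pos)
      (M.clockCfg .check m (marks s' s') (marks p' p') (marks q' q') (marks (j + 1) j) pos) := by
  obtain ⟨p', q', hp, h1⟩ := silent_loop (M := M) (m := m) (u := marks j 0) (pos := pos) (p := p)
    (q := q) (le_refl s)
  rw [Nat.sub_self] at h1
  have h2 := silent_addLeft (M := M) (m := m) (b := marks q' q') (u := marks j 0) (pos := pos)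
    (s := s) (le_refl p')
  have h3 := silent_addRight (M := M) (m := m) (c := marks (s + p') (s + p' : ℕ))
    (b := marks q' q') (u := marks j 0) (pos := pos) (le_refl p')
  have h4 := silent_extend (M := M) (m := m) (c := marks (s + p') (s + p' : ℕ))
    (f := marks p' p') (b := marks q' q') (pos := pos) (le_refl j)
  rw [Nat.sub_self] at h3 h4
  refine ⟨s + p', p', q', ?_, h1.trans (h2.trans (h3.trans h4))⟩
  nlinarith [Nat.zero_le (2 ^ s * p)]

end OracleTM

namespace OracleTM

open TMTape Clockwork

variable {M : OracleTM} {m : TapeName M.k → TMTape} {c f b u : TMTape} {pos : ℕ}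

/-! #### Running the machine -/

/-- The input of the simulated machine is written from right to left: the `d` marks made so far lie
to the right of the head, and a final move to the right puts the head on the first symbol. -/
theorem silent_copy {s j i d : ℕ} (hi : i ≤ j)
    (hm : ∀ z, (m .input).rel z = if 1 ≤ z ∧ z ≤ d then some true else none) :
    ∃ m' : TapeName M.k → TMTape, (∀ k, k ≠ .input → m' k = m k) ∧
      (m' .input).rel = (ofWord (List.replicate (d + i) true)).rel ∧
      M.clockwork.Silent (M.clockCfg .copy m (marks s s) f b (marks j (i - 1)) pos)
        (M.clockCfg (.run M.start) m' (marks (s + i) (s + i : ℕ)) f b (marks j 0) pos) := by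
  induction i generalizing m s d with
  | zero =>
    refine ⟨fun | .input => (m .input).act ((m .input).read, .right) | k => m k, ?_, ?_,
      .single (silentStep_clockCfg rfl rfl ?_)⟩
    · intro k hk
      cases k <;> first | exact absurd rfl hk | rfl
    · funext z
      simp only [rel_act_right, read_eq_rel, hm]
      simp only [rel, ofWord, zero_add, Nat.add_zero]
      by_cases h : 0 ≤ z
      · rw [if_neg (by omega), if_pos h]
        obtain ⟨n, rfl⟩ := Int.eq_ofNat_of_zero_le h
        by_cases hn : n < d
        · rw [if_pos (by omega)]
          simp [hn]
        · rw [if_neg (by omega)]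
          simp [not_lt.1 hn]
      · rw [if_neg h]
        split_ifs <;> first | rfl | omega
    · have h : (fun k => (m k).act ((M.clockAction .copy (fun i => (m i).read) (marks s s).read
          f.read b.read (marks j (-1)).read).main k)) =
          fun | .input => (m .input).act ((m .input).read, .right) | k => m k := by
        funext k
        simp only [clockAction, isSome_marks_neg, Bool.false_eq_true, if_false]
        cases k <;> simp
      simp only [Nat.cast_zero, zero_sub]
      rw [h]
      simp [clockAction, isSome_marks_neg, -Option.isSome_eq_false_iff]
  | succ i ih =>
    have h0 := isSome_marks_of_lt (a := j) (h := i) (by omega)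
    set m₁ : TapeName M.k → TMTape :=
      fun | .input => (m .input).act (some true, .left) | k => m k with hm₁
    obtain ⟨m', h1, h2, h3⟩ := ih (m := m₁) (s := s + 1) (d := d + 1) (by omega) (by
      intro z
      simp only [m₁, rel_act_left, hm]
      split_ifs <;> first | rfl | omega)
    refine ⟨m', fun k hk => ?_, ?_, .head (silentStep_clockCfg rfl rfl ?_) (h3.trans ?_)⟩
    · rw [h1 k hk]
      cases k <;> first | exact absurd rfl hk | rfl
    · rw [h2, show d + 1 + i = d + (i + 1) by ring]
    · have h : (fun k => (m k).act ((M.clockAction .copy (fun i => (m i).read) (marks s s).read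
          f.read b.read (marks j i).read).main k)) = m₁ := by
        funext k
        simp only [clockAction, h0, if_true]
        cases k <;> simp [m₁]
      rw [cast_succ_sub_one]
      simp only
      rw [h]
      simp [clockAction, h0]
    · rw [show s + 1 + i = s + (i + 1) by ring]

/-- Oracle questions are answered by `false`, in accordance with `zeroSeq`. The tapes agree with
those of the true run up to translation, and the bands record how far they may need to be erased. -/
theorem silent_run {w : List Bool} {s j n : ℕ}
    (hm : ∀ k, (m k).rel = ((M.init w).tape k).rel) (hb : ∀ k, Band (-j) j (m k))
    (hn : ∀ i < n, M.instr (M.cfgAt zeroSeq zeroSeq w i).state ≠ .halt) :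
    ∃ m' : TapeName M.k → TMTape,
      (∀ k, (m' k).rel = ((M.cfgAt zeroSeq zeroSeq w n).tape k).rel) ∧
      (∀ k, Band (-(j + n : ℕ)) (j + n : ℕ) (m' k)) ∧
      M.clockwork.Silent (M.clockCfg (.run M.start) m (marks s s) f b u pos)
        (M.clockCfg (.run (M.cfgAt zeroSeq zeroSeq w n).state) m'
          (marks (s + n) (s + n : ℕ)) f b u pos) := by
  induction n with
  | zero => exact ⟨m, hm, by simpa using hb, .refl⟩
  | succ n ih =>
    obtain ⟨m₁, h1, h2, h3⟩ := ih fun i hi => hn i (by omega)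
    have hne := hn n (Nat.lt_succ_self n)
    have hread : (fun k => (m₁ k).read) =
        fun k => ((M.cfgAt zeroSeq zeroSeq w n).tape k).read := by
      funext k
      rw [read_eq_rel, read_eq_rel, h1]
    have hpush : (marks (s + n) (s + n : ℕ)).act (some true, .right) =
        marks (s + (n + 1)) (s + (n + 1) : ℕ) := by
      rw [marks_act_push, ← add_assoc, Nat.cast_succ]
    rcases hi : M.instr (M.cfgAt zeroSeq zeroSeq w n).state with _ | g | ⟨o, g⟩
    · exact absurd hi hne
    · refine ⟨fun k => (m₁ k).act ((g fun k => (m₁ k).read).2 k), fun k => ?_, fun k => ?_,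
        h3.tail (silentStep_clockCfg rfl rfl ?_)⟩
      · rw [cfgAt_succ]
        simp only [step, hi]
        rw [hread]
        exact rel_act_congr (h1 k) _
      · have := (h2 k).act (by positivity) ((g fun k => (m₁ k).read).2 k)
        rw [show ((j + (n + 1) : ℕ) : ℤ) = (j + n : ℕ) + 1 by push_cast; ring]
        exact this
      · rw [cfgAt_succ]
        simp only [step, hi, clockAction, hread, hpush, act_read_stay]
    · have hs : M.step zeroSeq zeroSeq (M.cfgAt zeroSeq zeroSeq w n) =
          { M.cfgAt zeroSeq zeroSeq w n with state := g false } := by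
        cases o <;> simp [step, hi, zeroSeq]
      refine ⟨m₁, fun k => ?_, fun k => ?_, h3.tail (silentStep_clockCfg rfl rfl ?_)⟩
      · rw [cfgAt_succ, hs]
        exact h1 k
      · exact (h2 k).mono (by push_cast; omega) (by push_cast; omega)
      · rw [cfgAt_succ, hs]
        simp only [clockAction, hi, hpush, act_read_stay]

/-- Heads move right by as many cells as there are clock marks, which brings everything written to
their left; it can then be erased in one direction. -/
theorem silent_sweep₁ {s i : ℕ} {x y : ℤ} (hi : i ≤ s) (hm : ∀ k, Band x y (m k)) :
    ∃ m' : TapeName M.k → TMTape, (∀ k, Band (x - i) (y - i) (m' k)) ∧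
      M.clockwork.Silent (M.clockCfg .sweep₁ m (marks s (i - 1)) f b u pos)
        (M.clockCfg .sweep₂ m' (marks s 0) f b u pos) := by
  induction i generalizing m x y with
  | zero =>
    refine ⟨m, by simpa using hm, .single (silentStep_clockCfg rfl rfl ?_)⟩
    simp [clockAction, isSome_marks_neg, -Option.isSome_eq_false_iff]
  | succ i ih =>
    have h := isSome_marks_of_lt (a := s) (h := i) (by omega)
    obtain ⟨m', h1, h2⟩ := ih (m := fun k => (m k).act ((m k).read, .right)) (by omega)
      fun k => (hm k).act_right
    refine ⟨m', fun k => (h1 k).mono (by push_cast; omega) (by push_cast; omega),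
      .head (silentStep_clockCfg rfl rfl ?_) h2⟩
    rw [cast_succ_sub_one]
    simp [clockAction, h]

/-- A cell is also erased while the clock head stands on the blank behind the marks; this accounts
for the additional `1`. -/
theorem silent_sweep₂ {s i : ℕ} {x : ℤ} (hi : i ≤ s) (hm : ∀ k, Band x 0 (m k)) :
    ∃ m' : TapeName M.k → TMTape, (∀ k, Band (x + i + 1) 0 (m' k)) ∧
      M.clockwork.Silent (M.clockCfg .sweep₂ m (marks s (s - i : ℕ)) f b u pos)
        (M.clockCfg .sweep₃ m' (marks s (s - 1)) f b u pos) := by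
  induction i generalizing m x with
  | zero =>
    refine ⟨fun k => (m k).act (none, .left), fun k => by simpa using (hm k).erase,
      .single (silentStep_clockCfg rfl rfl ?_)⟩
    have h := isSome_marks_of_le (a := s) (h := s) le_rfl
    simp [clockAction, h, -Option.isSome_eq_false_iff]
  | succ i ih =>
    have h := isSome_marks_of_lt (a := s) (h := s - (i + 1)) (by omega)
    obtain ⟨m', h1, h2⟩ := ih (m := fun k => (m k).act (none, .left)) (by omega)
      fun k => (hm k).erase
    refine ⟨m', fun k => (h1 k).mono (by push_cast; omega) le_rfl,
      .head (silentStep_clockCfg rfl rfl ?_) h2⟩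
    have h2 : ((s - i : ℕ) : ℤ) = (s - (i + 1) : ℕ) + 1 := by omega
    rw [h2]
    simp [clockAction, h]

theorem silent_sweep₃ {s i : ℕ} {x : ℤ} (hi : i ≤ s) (hm : ∀ k, Band x 0 (m k)) :
    ∃ m' : TapeName M.k → TMTape, (∀ k, Band (x + i) 0 (m' k)) ∧
      M.clockwork.Silent (M.clockCfg .sweep₃ m (marks s (i - 1)) f b u pos)
        (M.clockCfg .loop m' (marks s 0) f b u pos) := by
  induction i generalizing m x with
  | zero =>
    refine ⟨m, by simpa using hm, .single (silentStep_clockCfg rfl rfl ?_)⟩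
    simp [clockAction, isSome_marks_neg, -Option.isSome_eq_false_iff]
  | succ i ih =>
    have h := isSome_marks_of_lt (a := s) (h := i) (by omega)
    obtain ⟨m', h1, h2⟩ := ih (m := fun k => (m k).act (none, .left)) (by omega)
      fun k => (hm k).erase
    refine ⟨m', fun k => (h1 k).mono (by push_cast; omega) le_rfl,
      .head (silentStep_clockCfg rfl rfl ?_) h2⟩
    rw [cast_succ_sub_one]
    simp [clockAction, h]

/-- One stage. -/
theorem silent_stage {s p q j n : ℕ} (hj : 0 < j) (hm : ∀ k, Band 1 0 (m k))
    (hn : ∀ i < n, M.instr (M.cfgAt zeroSeq zeroSeq (List.replicate j true) i).state ≠ .halt)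
    (hhalt : M.HaltsWithin zeroSeq zeroSeq (List.replicate j true) n) :
    ∃ (m' : TapeName M.k → TMTape) (s' p' q' : ℕ), (∀ k, Band 1 0 (m' k)) ∧
      2 ^ (s + j + n) ≤ s' ∧
      M.clockwork.Silent
        (M.clockCfg .copy m (marks s s) (marks p p) (marks q q) (marks j (j - 1)) pos)
        (M.clockCfg .check m' (marks s' s') (marks p' p') (marks q' q') (marks (j + 1) j) pos) := by
  have blank : ∀ k z, (m k).rel z = none := by
    intro k z
    by_contra hne
    have := hm k z hne
    omega
  obtain ⟨m₁, h1, h2, run₁⟩ := silent_copy (M := M) (m := m) (f := marks p p) (b := marks q q)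
    (pos := pos) (s := s) (d := 0) (le_refl j) (fun z => by
      rw [blank, if_neg (by push_cast; omega)])
  rw [Nat.zero_add] at h2
  have hrel : ∀ k, (m₁ k).rel = ((M.init (List.replicate j true)).tape k).rel := by
    intro k
    by_cases hk : k = .input
    · subst hk
      exact h2
    · rw [h1 k hk]
      funext z
      rw [blank]
      cases k <;> first | exact absurd rfl hk | simp [init, rel, ofWord]
  have hband : ∀ k, Band (-(j : ℤ)) j (m₁ k) := by
    intro k
    by_cases hk : k = .input
    · subst hk
      intro z hz
      rw [h2] at hz
      simp only [rel, ofWord, zero_add] at hz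
      split_ifs at hz with h0
      · obtain ⟨i, rfl⟩ := Int.eq_ofNat_of_zero_le h0
        have : i < j := by
          by_contra hc
          exact hz (by simp [not_lt.1 hc])
        omega
      · exact absurd rfl hz
    · rw [h1 k hk]
      intro z hz
      exact absurd (blank k z) hz
  obtain ⟨m₂, -, hband₂, run₂⟩ := silent_run (M := M) (f := marks p p) (b := marks q q)
    (u := marks j 0) (pos := pos) (s := s + j) hrel hband hn
  have hhalt' : M.instr (M.cfgAt zeroSeq zeroSeq (List.replicate j true) n).state = .halt := hhalt
  set S := s + j + n with hS
  have run₃ : M.clockwork.Silent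
      (M.clockCfg (.run (M.cfgAt zeroSeq zeroSeq (List.replicate j true) n).state) m₂
        (marks S S) (marks p p) (marks q q) (marks j 0) pos)
      (M.clockCfg .sweep₁ m₂ (marks S (S - 1)) (marks p p) (marks q q) (marks j 0) pos) := by
    refine .single (silentStep_clockCfg rfl rfl ?_)
    simp [clockAction, hhalt']
  -- All that was written lies within distance `S` of the heads. The band goes from `[-S, S]` to
  -- `[-2S, 0]`, then to `[-S + 1, 0]` after `S + 1` erasures, and to the empty `[1, 0]` after `S`
  -- more.
  obtain ⟨m₃, hband₃, run₄⟩ := silent_sweep₁ (M := M) (f := marks p p) (b := marks q q)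
    (u := marks j 0) (pos := pos) (le_refl S)
    (fun k => (hband₂ k).mono (a' := -S) (b' := S) (by omega) (by omega))
  obtain ⟨m₄, hband₄, run₅⟩ := silent_sweep₂ (M := M) (f := marks p p) (b := marks q q)
    (u := marks j 0) (pos := pos) (le_refl S)
    (fun k => (hband₃ k).mono (le_refl _) (b' := 0) (by omega))
  obtain ⟨m₅, hband₅, run₆⟩ := silent_sweep₃ (M := M) (f := marks p p) (b := marks q q)
    (u := marks j 0) (pos := pos) (le_refl S) hband₄
  rw [Nat.sub_self] at run₅
  obtain ⟨s', p', q', hs', run₇⟩ := silent_grow (M := M) (m := m₅) (s := S) (p := p) (q := q)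
    (j := j) (pos := pos)
  -- Growth gives `S + 2 ^ S ≤ s' + 1`, and `S ≥ 1` because the input is nonempty; so `2 ^ S ≤ s'`.
  refine ⟨m₅, s', p', q', fun k => (hband₅ k).mono (by omega) le_rfl, by omega,
    run₁.trans (run₂.trans (run₃.trans (run₄.trans (run₅.trans (run₆.trans run₇)))))⟩

/-! ### The times of the checks -/

/-- A lower bound for the clock at the `k`-th check, if `τ` is the running time of the machine. -/
def clockBound (τ : ℕ → ℕ) : ℕ → ℕ
  | 0 => 0
  | k + 1 => 2 ^ (clockBound τ k + (k + 3) + τ (k + 3))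

theorem exists_check_times_clockwork (M : OracleTM) (τ : ℕ → ℕ)
    (hτ : ∀ j, ∀ i < τ j,
      M.instr (M.cfgAt zeroSeq zeroSeq (List.replicate j true) i).state ≠ .halt)
    (hhalt : ∀ j, M.HaltsWithin zeroSeq zeroSeq (List.replicate j true) (τ j)) :
    ∃ e : ℕ → ℕ, StrictMono e ∧ (∀ k, clockBound τ k ≤ e k) ∧
      (∀ k, (M.clockwork.cfgAt (e k)).pos = 2 * k) ∧
      ∀ n, M.clockwork.checks n = true ↔ ∃ k, e k = n := by
  -- At check `k` the input tape has `k + 3` marks: two from the initial states and one from each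
  -- extension, the first of which precedes check `0`.
  let Stage : ℕ → M.clockwork.Cfg → Prop := fun k c => ∃ (m : TapeName M.k → TMTape) (s p q : ℕ),
    (∀ i, Band 1 0 (m i)) ∧ clockBound τ k ≤ s ∧
    c = M.clockCfg .check m (marks s s) (marks p p) (marks q q) (marks (k + 3) (k + 2 : ℕ)) (2 * k)
  have hstart : ∃ c, M.clockwork.Silent M.clockwork.init c ∧ Stage 0 c := by
    refine ⟨_, ?_, fun _ => ofWord [], 0, 0, 0, fun _ => band_blank, le_rfl, rfl⟩
    have h0 : M.clockwork.init = M.clockCfg .init₁ (fun _ => ofWord []) (marks 0 0) (marks 0 0)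
        (marks 0 0) (marks 0 (0 : ℕ)) 0 := by
      simp only [Clockwork.init, clockCfg]
      refine congrArg₂ (fun s t => Clockwork.Cfg.mk (W := M.clockwork) s t _) rfl ?_
      funext i
      rcases i with i | _ | _ | _ | _ <;> rfl
    rw [h0]
    refine .head (silentStep_clockCfg (q' := .init₂) (m' := fun _ => ofWord []) (c' := marks 0 0)
      (f' := marks 0 0) (b' := marks 0 0) (u' := marks 1 (1 : ℕ)) rfl rfl ?_) ?_
    · simp only [clockAction, act_read_stay, marks_act_push]
      rfl
    refine .head (silentStep_clockCfg (q' := .extend) (m' := fun _ => ofWord []) (c' := marks 0 0)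
      (f' := marks 0 0) (b' := marks 0 0) (u' := marks 2 (2 : ℕ)) rfl rfl ?_) ?_
    · simp only [clockAction, act_read_stay, marks_act_push]
      rfl
    have := silent_extend (M := M) (m := fun _ => ofWord []) (c := marks 0 0) (f := marks 0 0)
      (b := marks 0 0) (pos := 0) (j := 2) (Nat.zero_le _)
    exact this
  have hnext : ∀ k c, Stage k c →
      ∃ c', M.clockwork.Silent (M.clockwork.step c) c' ∧ Stage (k + 1) c' := by
    rintro k _ ⟨m, s, p, q, hm, hs, rfl⟩
    obtain ⟨m', s', p', q', hm', hs', hrun⟩ := silent_stage (M := M) (m := m) (pos := 2 * (k + 1))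
      (s := s) (p := p) (q := q) (j := k + 3) (by omega) hm (hτ _) (hhalt _)
    refine ⟨_, ?_, m', s', p', q', hm', ?_, rfl⟩
    · have h1 : M.clockwork.step (M.clockCfg .check m (marks s s) (marks p p) (marks q q)
          (marks (k + 3) (k + 2 : ℕ)) (2 * k)) = M.clockCfg .recover m (marks s s) (marks p p)
          (marks q q) (marks (k + 3) (k + 2 : ℕ)) (2 * k + 1) := by
        rw [clockwork_step]
        simp only [clockAction, act_read_stay]
        rfl
      have h2 : M.clockwork.step (M.clockCfg .recover m (marks s s) (marks p p) (marks q q)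
          (marks (k + 3) (k + 2 : ℕ)) (2 * k + 1)) = M.clockCfg .copy m (marks s s) (marks p p)
          (marks q q) (marks (k + 3) (k + 2 : ℕ)) (2 * (k + 1)) := by
        rw [clockwork_step]
        simp only [clockAction, act_read_stay]
        rfl
      rw [h1]
      refine .head ⟨rfl, h2.symm⟩ ?_
      have h3 : ((k + 3 : ℕ) : ℤ) - 1 = (k + 2 : ℕ) := by push_cast; ring
      rw [h3] at hrun
      exact hrun
    · refine le_trans ?_ hs'
      exact Nat.pow_le_pow_right (by norm_num) (by omega)
  obtain ⟨e, he, hstage, hchecks⟩ := M.clockwork.exists_check_times Stage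
    (by rintro k _ ⟨m, s, p, q, -, -, rfl⟩; rfl) hstart hnext
  refine ⟨e, he, fun k => ?_, fun k => ?_, hchecks⟩
  · obtain ⟨m, s, p, q, -, hs, hc⟩ := hstage k
    refine hs.trans ?_
    -- The clock head stands behind the `s` marks, and a head moves by at most one cell per step; so
    -- at least `s` steps have been made.
    have hw := M.clockwork.cfgAt_within (e k) (.inr .clock)
    rw [hc] at hw
    have hh := hw.1
    simp only [clockCfg, marks, wordAt] at hh
    rw [Nat.abs_cast] at hh
    exact_mod_cast hh
  · obtain ⟨m, s, p, q, -, hs, hc⟩ := hstage k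
    rw [hc]
    rfl

end OracleTM

/-! ### The theorem -/

open OracleTM in
theorem TimeConstructible.exists_oddChecks {t : ℕ → ℕ} (ht : TimeConstructible t) :
    ∃ (W : Clockwork) (g : ℕ → ℕ), StrictMono g ∧
      (∀ c : ℕ, ∀ᶠ k in atTop, ∀ i ≤ k + 1, 2 ^ (c * t i + c) ≤ g k) ∧
      (∀ k, (W.cfgAt (2 * g k + 1)).pos = 2 * k) ∧
      ∀ n, W.checks n = true ↔ ∃ k, 2 * g k + 1 = n := by
  obtain ⟨M, c₀, hM⟩ := ht
  classical
  have hex : ∀ j, ∃ n, M.HaltsWithin zeroSeq zeroSeq (List.replicate j true) n := fun j =>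
    ⟨_, (hM j).1⟩
  let τ : ℕ → ℕ := fun j => Nat.find (hex j)
  have hhalt : ∀ j, M.HaltsWithin zeroSeq zeroSeq (List.replicate j true) (τ j) := fun j =>
    Nat.find_spec (hex j)
  have hτ : ∀ j, ∀ i < τ j,
      M.instr (M.cfgAt zeroSeq zeroSeq (List.replicate j true) i).state ≠ .halt := fun j i hi =>
    Nat.find_min (hex j) hi
  -- The digits of `t j` have to be written within the running time `τ j`. This crude bound
  -- suffices, because the clock grows exponentially in each stage.
  have htτ : ∀ j, t j < 2 ^ τ j := by
    intro j
    have h := (M.cfgAt_within zeroSeq zeroSeq (List.replicate j true) (τ j)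
      (i := .numerator) (by simp)).number_lt
    rwa [← (hhalt j).cfgAt_eq (Nat.find_min' (hex j) (hM j).1), (hM j).2] at h
  obtain ⟨e, he, hbound, hpos, hchecks⟩ := M.exists_check_times_clockwork τ hτ hhalt
  obtain ⟨g, hg, heg, hpos', hchecks'⟩ := M.clockwork.exists_oddChecks he hpos hchecks
  refine ⟨M.clockwork.oddChecks, g, hg, fun c => ?_, hpos', hchecks'⟩
  have hmono : Monotone (clockBound τ) := by
    refine monotone_nat_of_le_succ fun k => ?_
    rw [clockBound]
    exact (Nat.lt_two_pow_self).le.trans (Nat.pow_le_pow_right (by norm_num) (by omega))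
  -- The machine is never run on inputs of length below three, so `t 0`, `t 1` and `t 2` are
  -- absorbed by the lower bound on `l`.
  have hsucc : ∀ l i, i ≤ l + 3 → c * (t 0 + 1) + c * (t 1 + 1) + c * (t 2 + 1) + c ≤ l →
      c * t i + c ≤ clockBound τ (l + 1) := by
    intro l i hi hl
    rw [clockBound]
    rcases lt_or_ge i 3 with h3 | h3
    · have h1 : c * t i + c ≤ l := by
        interval_cases i <;> nlinarith
      refine h1.trans ((Nat.lt_two_pow_self).le.trans (Nat.pow_le_pow_right (by norm_num) ?_))
      omega
    · have h1 : τ i ≤ clockBound τ l + τ (l + 3) := by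
        rcases hi.lt_or_eq with h | h
        · obtain ⟨l', rfl⟩ := Nat.exists_eq_add_of_le' h3
          refine le_trans ?_ (Nat.le_add_right _ _)
          refine le_trans ?_ (hmono (show l' + 1 ≤ l by omega))
          rw [clockBound]
          refine (Nat.lt_two_pow_self).le.trans (Nat.pow_le_pow_right (by norm_num) ?_)
          omega
        · subst h
          exact Nat.le_add_left _ _
      calc c * t i + c = c * (t i + 1) := by ring
        _ ≤ 2 ^ l * 2 ^ τ i :=
          Nat.mul_le_mul ((by omega : c ≤ l).trans (Nat.lt_two_pow_self).le) (htτ i)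
        _ = 2 ^ (l + τ i) := (pow_add _ _ _).symm
        _ ≤ _ := Nat.pow_le_pow_right (by norm_num) (by omega)
  filter_upwards [eventually_ge_atTop
    (c * (t 0 + 1) + c * (t 1 + 1) + c * (t 2 + 1) + c + 2)] with k hk i hi
  obtain ⟨l, rfl⟩ := Nat.exists_eq_add_of_le' (show 2 ≤ k by omega)
  have h1 := hsucc l i (by omega) (by omega)
  -- The exponential of one more stage turns the time bound into the reach of queries. The factor
  -- `4` leaves room for passing from `e k ≤ 2 * g k + 1` to `g k`.
  have h2 : 2 ^ (c * t i + c) * 4 ≤ clockBound τ (l + 2) := by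
    rw [clockBound, show (4 : ℕ) = 2 ^ 2 by norm_num, ← pow_add]
    exact Nat.pow_le_pow_right (by norm_num) (by omega)
  have h3 := (hbound (l + 2)).trans (heg (l + 2))
  have h4 : 0 < 2 ^ (c * t i + c) := by positivity
  omega

theorem mainTheorem8 (t : ℕ → ℕ) (ht : Superlinear t) (htc : TimeConstructible t) :
    ∃ A B : BinSeq, LookaheadRandom t B ∧ LookaheadRandomRel t B A ∧
      LookaheadNonrandom t (interleave A B) := by
  obtain ⟨W, g, hg, hbound, hpos, hchecks⟩ := htc.exists_oddChecks
  obtain ⟨A, B, hB, hA, hAB⟩ := exists_random_planted hg.injective hbound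
  refine ⟨A, B, hB, hA, W.lookaheadNonrandom ?_ ht ?_ ?_⟩
  · intro n hn
    obtain ⟨k, rfl⟩ := (hchecks n).1 hn
    rw [hpos]
    have := hg.id_le k
    simp only [id] at this
    omega
  · intro m
    refine ⟨2 * g m + 1, ?_, (hchecks _).2 ⟨m, rfl⟩⟩
    have := hg.id_le m
    simp only [id] at this
    omega
  · intro n hn
    obtain ⟨k, rfl⟩ := (hchecks n).1 hn
    rw [hpos]
    -- The odd position `2 * g k + 1` carries `B (g k)` and the even position `2 * k` carries `A k`;
    -- these agree because the bit was planted.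
    have h1 : (2 * g k + 1) / 2 = g k := by omega
    have h2 : (2 * g k + 1) % 2 ≠ 0 := by omega
    simp [interleave, h1, hAB]
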